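/- **Theorem (the $V$-ordered Lidskii formula).** Let $\mathcal{H}$ be an infinite-dimensional separable complex Hilbert space, and let $\mu_0(T)\ge\mu_1(T)\ge\dots$ denote the singular values of a bounded operator $T$ on $\mathcal{H}$, i.e. $\mu_k(T)=\inf\{\|T-F\| : \operatorname{rank}F\le k\}$. For $1\le q<\infty$ let $\mathcal{L}^{q,\infty}(\mathcal{H})$ be the set of compact operators $T$ for which there is a $C$ with $\mu_k(T)\le C(1+k)^{-1/q}$ for all $k\ge 0$, and let $\mathcal{L}^{\infty,\infty}(\mathcal{H})$ be the set of all bounded operators on $\mathcal{H}$. An extended limit is a state $\omega$ on $\ell^\infty(\mathbb{N})$ that vanishes on all sequences converging to $0$; one writes $\lim_{N\to\omega}c_N:=\omega(c)$. The Dixmier trace $\mathrm{tr}_\omega:\mathcal{L}^{1,\infty}(\mathcal{H})\to\mathbb{C}$ is the linear extension of $$\mathrm{tr}_\omega(G):=\lim_{N\to\omega}\frac{\sum_{k=0}^N\mu_k(G)}{\log N},\qquad G\ge 0 .$$ Let $p\in[1,\infty)$ and let $V\in\mathcal{L}^{p,\infty}(\mathcal{H})$ be strictly positive, i.e. positive with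 dense range. Let $(e_l)_{l\ge 0}$ be an orthonormal basis of $\mathcal{H}$ consisting of eigenvectors of $V$, ordered by decreasing eigenvalue. Let $G\in\mathcal{L}^{1,\infty}(\mathcal{H})$ be weakly $V$-modulated, i.e. the densely defined operator $GV^{-1}$ (with domain $V\mathcal{H}$) extends to a bounded operator belonging to $\mathcal{L}^{p/(p-1),\infty}(\mathcal{H})$, where $p/(p-1)=\infty$ if $p=1$. Then the sequence $$\mathrm{Res}(G)_N:=\frac{\sum_{l=0}^N\langle Ge_l,e_l\rangle}{\log(N+2)},\qquad N\ge 0,$$ is bounded, and for every extended limit $\omega$, $$\mathrm{tr}_\omega(G)=\omega(\mathrm{Res}(G))=\lim_{N\to\omega}\frac{\sum_{l=0}^N\langle Ge_l,e_l\rangle}{\log(N+2)} .$$ -/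

import Mathlib

open Filter Topology
open scoped ENNReal InnerProductSpace ComplexOrder

namespace DixmierTrace

variable {H : Type*} [NormedAddCommGroup H] [InnerProductSpace ℂ H]

/-! ### Singular values and weak Schatten ideals -/

/-- The `k`-th singular value `μ_k(T)` (`k = 0, 1, 2, …`, in decreasing order and counted with
multiplicity): the distance in operator norm from `T` to the operators of rank at most `k`.
That this is the decreasing enumeration of the square roots of the eigenvalues of `T* T` is
`singularValue_eq_of_eigenvectors` below. -/
noncomputable def singularValue (T : H →L[ℂ] H) (k : ℕ) : ℝ :=
  sInf {r : ℝ | ∃ F : H →L[ℂ] H, LinearMap.rank (F : H →ₗ[ℂ] H) ≤ (k : Cardinal) ∧ r = ‖T - F‖}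

/-- The weak Schatten ideal `L^{p,∞}(H)`: the compact operators with
`μ_k(T) ≤ C (1 + k)^{-1/p}` for all `k ≥ 0`. For `p = ∞` the bound only says that `T` is bounded,
and `L^{∞,∞}(H)` is the algebra of all bounded operators. -/
def IsWeakSchatten (p : ℝ≥0∞) (T : H →L[ℂ] H) : Prop :=
  (p ≠ ∞ → IsCompactOperator T) ∧
    ∃ C : ℝ, ∀ k : ℕ, singularValue T k ≤ C * (1 + (k : ℝ)) ^ (-(p⁻¹).toReal)

theorem singularValue_bddBelow (T : H →L[ℂ] H) (k : ℕ) :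
    BddBelow {r : ℝ | ∃ F : H →L[ℂ] H,
      LinearMap.rank (F : H →ₗ[ℂ] H) ≤ (k : Cardinal) ∧ r = ‖T - F‖} :=
  ⟨0, by rintro r ⟨F, -, rfl⟩; exact norm_nonneg _⟩

theorem singularValue_nonneg (T : H →L[ℂ] H) (k : ℕ) : 0 ≤ singularValue T k :=
  Real.sInf_nonneg (by rintro r ⟨F, -, rfl⟩; exact norm_nonneg _)

theorem singularValue_le (T F : H →L[ℂ] H) (k : ℕ)
    (hF : LinearMap.rank (F : H →ₗ[ℂ] H) ≤ (k : Cardinal)) : singularValue T k ≤ ‖T - F‖ :=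
  csInf_le (singularValue_bddBelow T k) ⟨F, hF, rfl⟩

theorem le_singularValue (T : H →L[ℂ] H) (k : ℕ) (c : ℝ)
    (h : ∀ F : H →L[ℂ] H, LinearMap.rank (F : H →ₗ[ℂ] H) ≤ (k : Cardinal) → c ≤ ‖T - F‖) :
    c ≤ singularValue T k := by
  refine le_csInf ⟨‖T - 0‖, 0, ?_, rfl⟩ ?_
  · simp
  · rintro r ⟨F, hF, rfl⟩
    exact h F hF

theorem exists_norm_sub_lt (T : H →L[ℂ] H) (k : ℕ) {ε : ℝ} (hε : 0 < ε) :
    ∃ F : H →L[ℂ] H, LinearMap.rank (F : H →ₗ[ℂ] H) ≤ (k : Cardinal) ∧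
      ‖T - F‖ < singularValue T k + ε := by
  by_contra! hcon
  have := le_singularValue T k _ hcon
  linarith

theorem isWeakSchatten_top (T : H →L[ℂ] H) : IsWeakSchatten ∞ T :=
  ⟨fun h => absurd rfl h, ‖T‖, fun k => by simpa using singularValue_le T 0 k (by simp)⟩

theorem finiteDimensional_range_of_rank_le {F : H →L[ℂ] H} {k : ℕ}
    (hF : LinearMap.rank (F : H →ₗ[ℂ] H) ≤ (k : Cardinal)) :
    FiniteDimensional ℂ (LinearMap.range (F : H →ₗ[ℂ] H)) :=
  Module.rank_lt_aleph0_iff.1 (lt_of_le_of_lt hF Cardinal.natCast_lt_aleph0)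

theorem isCompactOperator_of_rank_le {F : H →L[ℂ] H} {k : ℕ}
    (hF : LinearMap.rank (F : H →ₗ[ℂ] H) ≤ (k : Cardinal)) : IsCompactOperator F := by
  have := finiteDimensional_range_of_rank_le hF
  have h : F = (LinearMap.range (F : H →ₗ[ℂ] H)).subtypeL ∘L
      (F.codRestrict (LinearMap.range (F : H →ₗ[ℂ] H)) (fun x => ⟨x, rfl⟩)) := by
    ext x; rfl
  rw [h]
  have : ProperSpace (LinearMap.range (F : H →ₗ[ℂ] H)) :=
    FiniteDimensional.proper ℂ _
  have hsub : IsCompactOperator (LinearMap.range (F : H →ₗ[ℂ] H)).subtypeL :=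
    isCompactOperator_of_locallyCompactSpace_rng (LinearMap.range (F : H →ₗ[ℂ] H)).subtypeL
  exact hsub.comp_clm
    (F.codRestrict (LinearMap.range (F : H →ₗ[ℂ] H)) (fun x => ⟨x, rfl⟩))

theorem singularValue_add_le (S T : H →L[ℂ] H) (k : ℕ) :
    singularValue (S + T) k ≤ singularValue S (k / 2) + singularValue T (k / 2) := by
  refine le_of_forall_pos_le_add fun ε hε => ?_
  obtain ⟨F, hF, hF'⟩ := exists_norm_sub_lt S (k / 2) (half_pos hε)
  obtain ⟨G, hG, hG'⟩ := exists_norm_sub_lt T (k / 2) (half_pos hε)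
  refine (singularValue_le (S + T) (F + G) k ?_).trans ?_
  · refine (LinearMap.rank_add_le (F : H →ₗ[ℂ] H) (G : H →ₗ[ℂ] H)).trans ?_
    refine (add_le_add hF hG).trans ?_
    exact_mod_cast (by omega : k / 2 + k / 2 ≤ k)
  · rw [add_sub_add_comm]
    have := norm_add_le (S - F) (T - G)
    linarith

theorem norm_sq_sum_of_orthonormal {e : ℕ → H} (he : Orthonormal ℂ e) (S : Finset ℕ) (c : ℕ → ℂ) :
    ‖∑ i ∈ S, c i • e i‖ ^ 2 = ∑ i ∈ S, ‖c i‖ ^ 2 := by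
  have h : ((‖∑ i ∈ S, c i • e i‖ ^ 2 : ℝ) : ℂ) = ((∑ i ∈ S, ‖c i‖ ^ 2 : ℝ) : ℂ) := by
    push_cast
    refine (inner_self_eq_norm_sq_to_K (𝕜 := ℂ) (∑ i ∈ S, c i • e i)).symm.trans ?_
    rw [he.inner_sum]
    exact Finset.sum_congr rfl fun i _ => by rw [Complex.conj_mul']
  exact_mod_cast h

section Complete

variable [CompleteSpace H]

theorem isCompactOperator_of_singularValue_tendsto {T : H →L[ℂ] H}
    (h : Tendsto (singularValue T) atTop (𝓝 0)) : IsCompactOperator T := by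
  have key : ∀ n : ℕ, ∃ F : H →L[ℂ] H, IsCompactOperator F ∧
      ‖T - F‖ ≤ singularValue T n + 1 / ((n : ℝ) + 1) := by
    intro n
    obtain ⟨F, hF, hlt⟩ := exists_norm_sub_lt T n (ε := 1 / ((n : ℝ) + 1)) (by positivity)
    exact ⟨F, isCompactOperator_of_rank_le hF, hlt.le⟩
  choose F hFc hFn using key
  refine isCompactOperator_of_tendsto (l := atTop) (F := F) ?_ (Eventually.of_forall hFc)
  rw [tendsto_iff_norm_sub_tendsto_zero]
  refine squeeze_zero (fun _ => norm_nonneg _) (fun n => ?_)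
    (by simpa using h.add tendsto_one_div_add_atTop_nhds_zero_nat)
  rw [norm_sub_rev]
  simpa using hFn n

theorem isWeakSchatten_of_bound {p : ℝ≥0∞} (hp : p ≠ 0) {T : H →L[ℂ] H} {C : ℝ}
    (h : ∀ k : ℕ, singularValue T k ≤ C * (1 + (k : ℝ)) ^ (-(p⁻¹).toReal)) :
    IsWeakSchatten p T := by
  refine ⟨fun hp' => ?_, C, h⟩
  have hpos : 0 < (p⁻¹).toReal :=
    ENNReal.toReal_pos (ENNReal.inv_ne_zero.2 hp') (ENNReal.inv_ne_top.2 hp)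
  refine isCompactOperator_of_singularValue_tendsto
    (squeeze_zero (singularValue_nonneg T) h ?_)
  have h1 : Tendsto (fun k : ℕ => (1 + (k : ℝ))) atTop atTop :=
    tendsto_atTop_add_const_left _ _ tendsto_natCast_atTop_atTop
  simpa using ((tendsto_rpow_neg_atTop hpos).comp h1).const_mul C

theorem singularValue_le_of_norm_le {S T : H →L[ℂ] H} (h : ∀ x, ‖S x‖ ≤ ‖T x‖) (k : ℕ) :
    singularValue S k ≤ singularValue T k := by
  refine le_singularValue T k _ fun F hF => ?_
  let K : Submodule ℂ H := LinearMap.ker (F : H →ₗ[ℂ] H)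
  have : CompleteSpace K := F.isClosed_ker.completeSpace_coe
  have hrank : LinearMap.rank ((Kᗮ.starProjection : H →L[ℂ] H) : H →ₗ[ℂ] H) ≤ (k : Cardinal) := by
    have h1 : LinearMap.range ((Kᗮ.starProjection : H →L[ℂ] H) : H →ₗ[ℂ] H) = Kᗮ := by
      simp
    rw [LinearMap.rank, h1]
    refine le_trans ?_ hF
    let g : Kᗮ →ₗ[ℂ] LinearMap.range (F : H →ₗ[ℂ] H) :=
      (F : H →ₗ[ℂ] H).rangeRestrict ∘ₗ Kᗮ.subtype
    refine LinearMap.rank_le_of_injective g ?_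
    rw [← LinearMap.ker_eq_bot, LinearMap.ker_eq_bot']
    intro x hx
    have hx' : F x = 0 := congrArg Subtype.val hx
    have hxK : (x : H) ∈ K := hx'
    have := Submodule.inner_right_of_mem_orthogonal hxK x.2
    exact Subtype.ext (inner_self_eq_zero.1 this)
  refine (singularValue_le S (S ∘L Kᗮ.starProjection) k ?_).trans ?_
  · refine le_trans ?_ hrank
    exact LinearMap.rank_comp_le_right _ _
  · refine ContinuousLinearMap.opNorm_le_bound _ (norm_nonneg _) fun x => ?_
    have hx : x - Kᗮ.starProjection x = K.starProjection x := by
      have := K.starProjection_add_starProjection_orthogonal x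
      rw [sub_eq_iff_eq_add]; exact this.symm
    have hmem : F (K.starProjection x) = 0 := K.starProjection_apply_mem x
    calc ‖(S - S ∘L Kᗮ.starProjection) x‖ = ‖S (K.starProjection x)‖ := by
          rw [← hx]; simp
      _ ≤ ‖T (K.starProjection x)‖ := h _
      _ = ‖(T - F) (K.starProjection x)‖ := by simp [hmem]
      _ ≤ ‖T - F‖ * ‖K.starProjection x‖ := ContinuousLinearMap.le_opNorm _ _
      _ ≤ ‖T - F‖ * ‖x‖ := by
          gcongr
          exact K.norm_starProjection_apply_le x

theorem singularValue_star_le (T : H →L[ℂ] H) (k : ℕ) :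
    singularValue (star T) k ≤ singularValue T k := by
  refine le_singularValue T k _ fun F hF => ?_
  have := finiteDimensional_range_of_rank_le hF
  let R : Submodule ℂ H := LinearMap.range (F : H →ₗ[ℂ] H)
  have : FiniteDimensional ℂ R := finiteDimensional_range_of_rank_le hF
  refine (singularValue_le (star T) (star F) k ?_).trans ?_
  · have hcomp : star F = star F ∘L R.starProjection := by
      have h1 : F = R.starProjection ∘L F := by
        ext x
        exact (Submodule.starProjection_eq_self_iff.2 (⟨x, rfl⟩ : F x ∈ R)).symm
      have h2 : star R.starProjection = R.starProjection :=
        (isSelfAdjoint_starProjection R).star_eq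
      have h3 : star F = star (R.starProjection * F) := congrArg star h1
      rw [star_mul, h2] at h3
      exact h3
    rw [hcomp]
    refine (LinearMap.rank_comp_le_right (R.starProjection : H →ₗ[ℂ] H)
      ((star F : H →L[ℂ] H) : H →ₗ[ℂ] H)).trans ?_
    have h4 : LinearMap.range (R.starProjection : H →ₗ[ℂ] H) = R := by simp
    rw [LinearMap.rank, h4]
    exact hF
  · rw [← star_sub, norm_star]

theorem singularValue_smul_le (c : ℂ) (T : H →L[ℂ] H) (k : ℕ) :
    singularValue (c • T) k ≤ ‖c‖ * singularValue T k := by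
  refine le_of_forall_pos_le_add fun ε hε => ?_
  obtain ⟨F, hF, hF'⟩ := exists_norm_sub_lt T k (ε := ε / (‖c‖ + 1)) (by positivity)
  refine (singularValue_le (c • T) (c • F) k ?_).trans ?_
  · refine le_trans ?_ hF
    have : ((c • F : H →L[ℂ] H) : H →ₗ[ℂ] H) =
        (c • LinearMap.id : H →ₗ[ℂ] H) ∘ₗ (F : H →ₗ[ℂ] H) := by ext x; simp
    rw [this]
    exact LinearMap.rank_comp_le_right _ _
  · rw [← smul_sub, norm_smul]
    have h1 : ‖c‖ * ‖T - F‖ ≤ ‖c‖ * (singularValue T k + ε / (‖c‖ + 1)) := by gcongr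
    have h2 : ‖c‖ * (ε / (‖c‖ + 1)) ≤ ε := by
      rw [mul_div_assoc', div_le_iff₀ (by positivity)]
      nlinarith [norm_nonneg c]
    linarith

theorem IsWeakSchatten.add {p : ℝ≥0∞} (hp : p ≠ 0) {S T : H →L[ℂ] H}
    (hS : IsWeakSchatten p S) (hT : IsWeakSchatten p T) : IsWeakSchatten p (S + T) := by
  obtain ⟨-, C, hC⟩ := hS
  obtain ⟨-, D, hD⟩ := hT
  have hC0 : 0 ≤ C := by simpa using (singularValue_nonneg S 0).trans (hC 0)
  have hD0 : 0 ≤ D := by simpa using (singularValue_nonneg T 0).trans (hD 0)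
  set s := (p⁻¹).toReal with hs
  have hs0 : 0 ≤ s := ENNReal.toReal_nonneg
  refine isWeakSchatten_of_bound hp (C := (C + D) * (1 / 2 : ℝ) ^ (-s)) fun k => ?_
  have h1 : (1 + ((k / 2 : ℕ) : ℝ)) ^ (-s) ≤ (1 / 2 : ℝ) ^ (-s) * (1 + (k : ℝ)) ^ (-s) := by
    rw [← Real.mul_rpow (by norm_num) (by positivity)]
    refine Real.rpow_le_rpow_of_nonpos (by positivity) ?_ (by linarith)
    have h2 : k ≤ 2 * (k / 2) + 1 := by omega
    have h3 : (k : ℝ) ≤ 2 * ((k / 2 : ℕ) : ℝ) + 1 := by exact_mod_cast h2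
    linarith
  calc singularValue (S + T) k ≤ _ := singularValue_add_le S T k
    _ ≤ C * (1 + ((k / 2 : ℕ) : ℝ)) ^ (-s) + D * (1 + ((k / 2 : ℕ) : ℝ)) ^ (-s) :=
        add_le_add (hC _) (hD _)
    _ = (C + D) * (1 + ((k / 2 : ℕ) : ℝ)) ^ (-s) := by ring
    _ ≤ (C + D) * ((1 / 2 : ℝ) ^ (-s) * (1 + (k : ℝ)) ^ (-s)) := by gcongr
    _ = _ := by ring

theorem IsWeakSchatten.star {p : ℝ≥0∞} (hp : p ≠ 0) {T : H →L[ℂ] H}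
    (hT : IsWeakSchatten p T) : IsWeakSchatten p (star T) := by
  obtain ⟨-, C, hC⟩ := hT
  exact isWeakSchatten_of_bound hp fun k => (singularValue_star_le T k).trans (hC k)

theorem IsWeakSchatten.smul {p : ℝ≥0∞} (hp : p ≠ 0) (c : ℂ) {T : H →L[ℂ] H}
    (hT : IsWeakSchatten p T) : IsWeakSchatten p (c • T) := by
  obtain ⟨-, C, hC⟩ := hT
  refine isWeakSchatten_of_bound hp (C := ‖c‖ * C) fun k => ?_
  rw [mul_assoc]
  exact (singularValue_smul_le c T k).trans (mul_le_mul_of_nonneg_left (hC k) (norm_nonneg c))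

theorem IsWeakSchatten.of_norm_le {p : ℝ≥0∞} (hp : p ≠ 0) {S T : H →L[ℂ] H}
    (hT : IsWeakSchatten p T) (h : ∀ x, ‖S x‖ ≤ ‖T x‖) : IsWeakSchatten p S := by
  obtain ⟨-, C, hC⟩ := hT
  exact isWeakSchatten_of_bound hp fun k => (singularValue_le_of_norm_le h k).trans (hC k)

theorem norm_sq_eq_posPart_add_negPart {A : H →L[ℂ] H} (hA : IsSelfAdjoint A) (x : H) :
    ‖A x‖ ^ 2 = ‖A⁺ x‖ ^ 2 + ‖A⁻ x‖ ^ 2 := by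
  have h1 : A x = A⁺ x - A⁻ x := by
    conv_lhs => rw [← CFC.posPart_sub_negPart A hA]
    rfl
  have hsa : IsSelfAdjoint A⁺ := (CFC.posPart_nonneg A).isSelfAdjoint
  have h2 : ⟪A⁺ x, A⁻ x⟫_ℂ = 0 := by
    have h3 : ⟪A⁺ x, A⁻ x⟫_ℂ = ⟪x, (A⁺ * A⁻) x⟫_ℂ := hsa.isSymmetric x (A⁻ x)
    rw [h3, CFC.posPart_mul_negPart]
    simp
  have h4 := norm_sub_sq (𝕜 := ℂ) (A⁺ x) (A⁻ x)
  rw [h2] at h4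
  rw [h1, h4]
  simp

theorem IsWeakSchatten.posPart {p : ℝ≥0∞} (hp : p ≠ 0) {A : H →L[ℂ] H} (hA : IsSelfAdjoint A)
    (h : IsWeakSchatten p A) : IsWeakSchatten p A⁺ :=
  h.of_norm_le hp fun x => by
    refine le_of_sq_le_sq ?_ (norm_nonneg _)
    rw [norm_sq_eq_posPart_add_negPart hA]
    linarith [sq_nonneg ‖A⁻ x‖]

theorem IsWeakSchatten.negPart {p : ℝ≥0∞} (hp : p ≠ 0) {A : H →L[ℂ] H} (hA : IsSelfAdjoint A)
    (h : IsWeakSchatten p A) : IsWeakSchatten p A⁻ :=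
  h.of_norm_le hp fun x => by
    refine le_of_sq_le_sq ?_ (norm_nonneg _)
    rw [norm_sq_eq_posPart_add_negPart hA]
    linarith [sq_nonneg ‖A⁺ x‖]

theorem IsWeakSchatten.realPart {p : ℝ≥0∞} (hp : p ≠ 0) {T : H →L[ℂ] H}
    (hT : IsWeakSchatten p T) : IsWeakSchatten p (realPart T : H →L[ℂ] H) := by
  have h : (_root_.realPart T : H →L[ℂ] H) = ((2⁻¹ : ℝ) : ℂ) • (T + Star.star T) := by
    rw [realPart_apply_coe]
    exact (Complex.coe_smul _ _).symm
  rw [h]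
  exact (hT.add hp (hT.star hp)).smul hp _

theorem IsWeakSchatten.imaginaryPart {p : ℝ≥0∞} (hp : p ≠ 0) {T : H →L[ℂ] H}
    (hT : IsWeakSchatten p T) : IsWeakSchatten p (imaginaryPart T : H →L[ℂ] H) := by
  have h : (_root_.imaginaryPart T : H →L[ℂ] H) =
      (-Complex.I) • ((2⁻¹ : ℝ) : ℂ) • (T + (-1 : ℂ) • Star.star T) := by
    rw [imaginaryPart_apply_coe, neg_one_smul, ← sub_eq_add_neg]
    congr 1
  rw [h]
  exact ((hT.add hp ((hT.star hp).smul hp _)).smul hp _).smul hp _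

section Eigenvectors

variable {T : H →L[ℂ] H} {e : ℕ → H} {s : ℕ → ℝ}

theorem norm_sq_map_sum_of_orthonormal (he : Orthonormal ℂ e)
    (hT : ∀ k, star T (T (e k)) = ((s k ^ 2 : ℝ) : ℂ) • e k) (S : Finset ℕ) (c : ℕ → ℂ) :
    ‖T (∑ i ∈ S, c i • e i)‖ ^ 2 = ∑ i ∈ S, s i ^ 2 * ‖c i‖ ^ 2 := by
  have h : ((‖T (∑ i ∈ S, c i • e i)‖ ^ 2 : ℝ) : ℂ) =
      ((∑ i ∈ S, s i ^ 2 * ‖c i‖ ^ 2 : ℝ) : ℂ) := by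
    push_cast
    have h1 : star T (T (∑ i ∈ S, c i • e i)) =
        ∑ i ∈ S, (((s i ^ 2 : ℝ) : ℂ) * c i) • e i := by
      simp only [map_sum, map_smul, hT, smul_smul]
      exact Finset.sum_congr rfl fun i _ => by rw [mul_comm]
    have h2 : ⟪T (∑ i ∈ S, c i • e i), T (∑ i ∈ S, c i • e i)⟫_ℂ =
        ⟪∑ i ∈ S, c i • e i, star T (T (∑ i ∈ S, c i • e i))⟫_ℂ := by
      rw [ContinuousLinearMap.star_eq_adjoint, ContinuousLinearMap.adjoint_inner_right]
    have h3 := inner_self_eq_norm_sq_to_K (𝕜 := ℂ) (T (∑ i ∈ S, c i • e i))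
    refine h3.symm.trans ?_
    rw [h2, h1, he.inner_sum]
    refine Finset.sum_congr rfl fun i _ => ?_
    rw [← Complex.conj_mul']
    push_cast
    ring
  exact_mod_cast h

/-- If `e_0, e_1, …` are orthonormal eigenvectors of `T* T` with decreasing eigenvalues `s_k ^ 2`
and `T` vanishes on their orthogonal complement, then `μ_k(T) = s_k`. -/
theorem singularValue_eq_of_eigenvectors (he : Orthonormal ℂ e) (hs : Antitone s)
    (hs0 : ∀ k, 0 ≤ s k) (hT : ∀ k, star T (T (e k)) = ((s k ^ 2 : ℝ) : ℂ) • e k)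
    (hT0 : ∀ x, (∀ k, ⟪e k, x⟫_ℂ = 0) → T x = 0) (k : ℕ) : singularValue T k = s k := by
  apply le_antisymm
  · let M : Submodule ℂ H := Submodule.span ℂ (e '' (Finset.range k : Set ℕ))
    have : FiniteDimensional ℂ M :=
      FiniteDimensional.span_of_finite ℂ ((Finset.range k).finite_toSet.image e)
    have hspan : ∀ w ∈ Submodule.span ℂ (Set.range e), ‖T (w - M.starProjection w)‖ ≤
        s k * ‖w‖ := by
      intro w hw
      have hmem : w - M.starProjection w ∈ Submodule.span ℂ (Set.range e) :=
        Submodule.sub_mem _ hw (Submodule.span_mono (Set.image_subset_range _ _)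
          (M.starProjection_apply_mem w))
      have hle : ‖w - M.starProjection w‖ ≤ ‖w‖ := by
        rw [← Submodule.starProjection_orthogonal_val]
        exact Submodule.norm_starProjection_apply_le _ _
      have horth : ∀ i < k, ⟪e i, w - M.starProjection w⟫_ℂ = 0 := fun i hi =>
        Submodule.inner_right_of_mem_orthogonal
          (Submodule.subset_span ⟨i, by simpa using hi, rfl⟩ : e i ∈ M)
          (M.sub_starProjection_mem_orthogonal w)
      refine le_trans ?_ (mul_le_mul_of_nonneg_left hle (hs0 k))
      generalize w - M.starProjection w = y at hmem horth
      obtain ⟨c, rfl⟩ := Finsupp.mem_span_range_iff_exists_finsupp.1 hmem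
      rw [Finsupp.sum] at horth ⊢
      refine le_of_sq_le_sq ?_ (mul_nonneg (hs0 k) (norm_nonneg _))
      rw [mul_pow, norm_sq_map_sum_of_orthonormal he hT, norm_sq_sum_of_orthonormal he,
        Finset.mul_sum]
      refine Finset.sum_le_sum fun i hi => ?_
      have hik : k ≤ i := by
        by_contra! hlt
        have := horth i hlt
        rw [he.inner_right_sum _ hi] at this
        exact (Finsupp.mem_support_iff.1 hi) this
      have := hs hik
      have := hs0 i
      gcongr
    let L : Submodule ℂ H := (Submodule.span ℂ (Set.range e)).topologicalClosure
    have hclos : ∀ w ∈ L, ‖T (w - M.starProjection w)‖ ≤ s k * ‖w‖ := by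
      intro w hw
      have hcl : IsClosed {w : H | ‖T (w - M.starProjection w)‖ ≤ s k * ‖w‖} :=
        isClosed_le (by fun_prop) (by fun_prop)
      exact closure_minimal (fun w hw => hspan w hw) hcl hw
    have : CompleteSpace L :=
      (Submodule.isClosed_topologicalClosure _).completeSpace_coe
    refine (singularValue_le T (T ∘L M.starProjection) k ?_).trans ?_
    · refine (LinearMap.rank_comp_le_right (M.starProjection : H →ₗ[ℂ] H)
        (T : H →ₗ[ℂ] H)).trans ?_
      have h4 : LinearMap.range (M.starProjection : H →ₗ[ℂ] H) = M := by simp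
      rw [LinearMap.rank, h4]
      classical
      have h5 : M = Submodule.span ℂ (((Finset.range k).image e : Finset H) : Set H) := by
        rw [Finset.coe_image]
      rw [h5]
      refine (rank_span_finset_le _).trans ?_
      exact_mod_cast Finset.card_image_le.trans (Finset.card_range k).le
    · refine ContinuousLinearMap.opNorm_le_bound _ (hs0 k) fun x => ?_
      have hML : ∀ y ∈ M, y ∈ L := fun y hy =>
        Submodule.le_topologicalClosure _ (Submodule.span_mono (Set.image_subset_range _ _) hy)
      have hx0 : T (x - L.starProjection x) = 0 := hT0 _ fun i =>
        Submodule.inner_right_of_mem_orthogonal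
          (Submodule.le_topologicalClosure _ (Submodule.subset_span ⟨i, rfl⟩) : e i ∈ L)
          (L.sub_starProjection_mem_orthogonal x)
      have hMx : M.starProjection (x - L.starProjection x) = 0 := by
        rw [Submodule.starProjection_apply_eq_zero_iff]
        exact fun y hy => Submodule.inner_right_of_mem_orthogonal (hML y hy)
          (L.sub_starProjection_mem_orthogonal x)
      have h6 : (T - T ∘L M.starProjection) x =
          T (L.starProjection x - M.starProjection (L.starProjection x)) := by
        rw [map_sub, sub_eq_zero] at hx0 hMx
        simp [hx0, hMx]
      rw [h6]
      exact (hclos _ (L.starProjection_apply_mem x)).trans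
        (mul_le_mul_of_nonneg_left (L.norm_starProjection_apply_le x) (hs0 k))
  · refine le_singularValue T k _ fun F hF => ?_
    let g : (Fin (k + 1) → ℂ) →ₗ[ℂ] H := Fintype.linearCombination ℂ (fun i : Fin (k + 1) => e i)
    have hker : ∃ c, c ≠ 0 ∧ F (g c) = 0 := by
      by_contra! hcon
      have hinj : Function.Injective ((F : H →ₗ[ℂ] H).rangeRestrict ∘ₗ g) := by
        rw [← LinearMap.ker_eq_bot, LinearMap.ker_eq_bot']
        intro c hc
        by_contra hne
        exact hcon c hne (congrArg Subtype.val hc)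
      have h1 := LinearMap.lift_rank_le_of_injective _ hinj
      rw [rank_fin_fun] at h1
      have h2 : Cardinal.lift (Module.rank ℂ (LinearMap.range (F : H →ₗ[ℂ] H))) ≤ (k : Cardinal) := by
        simpa using hF
      have h3 := h1.trans h2
      simp only [Cardinal.lift_natCast] at h3
      have h4 : k + 1 ≤ k := by exact_mod_cast h3
      omega
    obtain ⟨c, hc, hFc⟩ := hker
    let d : ℕ → ℂ := fun i => if h : i < k + 1 then c ⟨i, h⟩ else 0
    have hg : g c = ∑ i ∈ Finset.range (k + 1), d i • e i := by
      rw [Finset.sum_range]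
      simp only [g, d, Fintype.linearCombination_apply]
      exact Finset.sum_congr rfl fun i _ => by rw [dif_pos i.2]
    have hTg : s k * ‖g c‖ ≤ ‖T (g c)‖ := by
      refine le_of_sq_le_sq ?_ (norm_nonneg _)
      rw [mul_pow, hg, norm_sq_map_sum_of_orthonormal he hT, norm_sq_sum_of_orthonormal he,
        Finset.mul_sum]
      refine Finset.sum_le_sum fun i hi => ?_
      have := hs (Nat.lt_succ_iff.1 (Finset.mem_range.1 hi))
      have := hs0 k
      gcongr
    have hg0 : 0 < ‖g c‖ := by
      rw [norm_pos_iff]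
      intro h0
      have hli : LinearIndependent ℂ (fun i : Fin (k + 1) => e i) :=
        he.linearIndependent.comp _ Fin.val_injective
      exact hc (funext (Fintype.linearIndependent_iff.1 hli c
        (by simpa [g, Fintype.linearCombination_apply] using h0)))
    have h5 : T (g c) = (T - F) (g c) := by simp [hFc]
    rw [h5] at hTg
    exact le_of_mul_le_mul_right (hTg.trans ((T - F).le_opNorm _)) hg0

end Eigenvectors

/-! ### Extended limits and Dixmier traces -/

end Complete

/-- `ω` is an extended limit: a state on `ℓ^∞(ℕ)` (a positive unital functional) that vanishes on
the sequences converging to `0`. -/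
structure IsExtendedLimit (ω : lp (fun _ : ℕ => ℂ) ∞ →L[ℂ] ℂ) : Prop where
  map_one : ω 1 = 1
  nonneg : ∀ c : lp (fun _ : ℕ => ℂ) ∞, (∀ n, 0 ≤ c n) → 0 ≤ ω c
  singular : ∀ c : lp (fun _ : ℕ => ℂ) ∞, Tendsto (fun n => c n) atTop (𝓝 0) → ω c = 0

/-- The sequence `N ↦ (∑_{k=0}^N μ_k(G)) / log N`. (Its terms `N = 0, 1`, where `log N` is not a
positive number, are `0` in Lean; a functional vanishing on `c_0(ℕ)` does not see them.) -/
noncomputable def dixmierSeq (G : H →L[ℂ] H) (N : ℕ) : ℂ :=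
  (((∑ k ∈ Finset.range (N + 1), singularValue G k) / Real.log N : ℝ) : ℂ)

theorem memℓp_dixmierSeq {G : H →L[ℂ] H} (hG : IsWeakSchatten 1 G) :
    Memℓp (dixmierSeq G) ∞ := by
  obtain ⟨-, C, hC⟩ := hG
  have hC0 : 0 ≤ C := by simpa using (singularValue_nonneg G 0).trans (hC 0)
  refine memℓp_infty ⟨C * (2 / Real.log 2 + 2), ?_⟩
  rintro _ ⟨N, rfl⟩
  have hsum0 : 0 ≤ ∑ k ∈ Finset.range (N + 1), singularValue G k :=
    Finset.sum_nonneg fun k _ => singularValue_nonneg G k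
  have hlog2 : 0 < Real.log 2 := Real.log_pos (by norm_num)
  simp only [dixmierSeq, Complex.norm_real, Real.norm_eq_abs]
  rcases lt_or_ge N 2 with hN | hN
  · have : Real.log N = 0 := by interval_cases N <;> simp
    rw [this]
    simp only [div_zero, abs_zero]
    positivity
  have hN' : (2 : ℝ) ≤ N := by exact_mod_cast hN
  have hlog : Real.log 2 ≤ Real.log N := Real.log_le_log (by norm_num) hN'
  have hlog0 : 0 < Real.log N := hlog2.trans_le hlog
  rw [abs_of_nonneg (by positivity), div_le_iff₀ hlog0]
  have h1 : ∑ k ∈ Finset.range (N + 1), singularValue G k ≤ C * (harmonic (N + 1) : ℝ) := by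
    rw [harmonic]
    push_cast
    rw [Finset.mul_sum]
    refine Finset.sum_le_sum fun k _ => (hC k).trans (le_of_eq ?_)
    simp [Real.rpow_neg_one, add_comm]
  have h2 : (harmonic (N + 1) : ℝ) ≤ 1 + Real.log ((N + 1 : ℕ) : ℝ) :=
    harmonic_le_one_add_log (N + 1)
  have h3 : Real.log ((N + 1 : ℕ) : ℝ) ≤ 2 * Real.log N := by
    have : Real.log ((N + 1 : ℕ) : ℝ) ≤ Real.log ((N : ℝ) ^ 2) :=
      Real.log_le_log (by positivity) (by push_cast; nlinarith)
    simpa using this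
  have h4 : 1 ≤ 1 / Real.log 2 * Real.log N := by
    rw [one_div, inv_mul_eq_div, le_div_iff₀ hlog2]; linarith
  have h5 : (harmonic (N + 1) : ℝ) ≤ (2 / Real.log 2 + 2) * Real.log N := by
    have : (2 / Real.log 2) * Real.log N = 2 * (1 / Real.log 2 * Real.log N) := by ring
    rw [add_mul, this]; linarith
  calc _ ≤ C * (harmonic (N + 1) : ℝ) := h1
    _ ≤ C * ((2 / Real.log 2 + 2) * Real.log N) := by gcongr
    _ = _ := by ring

/-- `ω` applied to the bounded sequence `(∑_{k=0}^N μ_k(G)) / log N`, for `G ∈ L^{1,∞}(H)`. For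
`G ≥ 0` this is the Dixmier trace of `G`. -/
noncomputable def dixmierTracePos (ω : lp (fun _ : ℕ => ℂ) ∞ →L[ℂ] ℂ) (G : H →L[ℂ] H)
    (hG : IsWeakSchatten 1 G) : ℂ :=
  ω ⟨dixmierSeq G, memℓp_dixmierSeq hG⟩

/-- The Dixmier trace `tr_ω : L^{1,∞}(H) → ℂ`: the linear extension of its values on the positive
operators, through
`G = (Re G)₊ - (Re G)₋ + i ((Im G)₊ - (Im G)₋)`. -/
noncomputable def dixmierTrace [CompleteSpace H] (ω : lp (fun _ : ℕ => ℂ) ∞ →L[ℂ] ℂ)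
    (G : H →L[ℂ] H) (hG : IsWeakSchatten 1 G) : ℂ :=
  (dixmierTracePos ω (realPart G : H →L[ℂ] H)⁺
      ((hG.realPart one_ne_zero).posPart one_ne_zero (realPart G).2) -
    dixmierTracePos ω (realPart G : H →L[ℂ] H)⁻
      ((hG.realPart one_ne_zero).negPart one_ne_zero (realPart G).2)) +
  Complex.I *
    (dixmierTracePos ω (imaginaryPart G : H →L[ℂ] H)⁺
        ((hG.imaginaryPart one_ne_zero).posPart one_ne_zero (imaginaryPart G).2) -
      dixmierTracePos ω (imaginaryPart G : H →L[ℂ] H)⁻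
        ((hG.imaginaryPart one_ne_zero).negPart one_ne_zero (imaginaryPart G).2))

/-- On positive operators `tr_ω` is given by the singular values of the operator itself. -/
theorem dixmierTrace_of_nonneg [CompleteSpace H] (ω : lp (fun _ : ℕ => ℂ) ∞ →L[ℂ] ℂ)
    {G : H →L[ℂ] H} (hG : IsWeakSchatten 1 G) (h : 0 ≤ G) :
    dixmierTrace ω G hG = dixmierTracePos ω G hG := by
  have h0 : ∀ k, singularValue (0 : H →L[ℂ] H) k = 0 := fun k =>
    le_antisymm (by simpa using singularValue_le (0 : H →L[ℂ] H) 0 k (by simp))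
      (singularValue_nonneg _ _)
  have hz : ∀ (Z : H →L[ℂ] H) (hZ : IsWeakSchatten 1 Z), Z = 0 → dixmierTracePos ω Z hZ = 0 := by
    rintro Z hZ rfl
    have : (⟨dixmierSeq 0, memℓp_dixmierSeq hZ⟩ : lp (fun _ : ℕ => ℂ) ∞) = 0 := by
      ext N
      simp [dixmierSeq, h0]
    rw [dixmierTracePos, this, map_zero]
  have hc : ∀ (Y Z : H →L[ℂ] H) (hY : IsWeakSchatten 1 Y) (hZ : IsWeakSchatten 1 Z), Y = Z →
      dixmierTracePos ω Y hY = dixmierTracePos ω Z hZ := by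
    rintro Y Z hY hZ rfl
    rfl
  have hre : (realPart G : H →L[ℂ] H) = G := h.isSelfAdjoint.coe_realPart
  have him : (imaginaryPart G : H →L[ℂ] H) = 0 := by rw [h.isSelfAdjoint.imaginaryPart]; rfl
  rw [dixmierTrace, hc _ G _ hG (by rw [hre]; exact (CFC.posPart_eq_self G).2 h),
    hz (realPart G : H →L[ℂ] H)⁻ _ (by rw [hre]; exact (CFC.negPart_eq_zero_iff G h.isSelfAdjoint).2 h),
    hz (imaginaryPart G : H →L[ℂ] H)⁺ _ (by rw [him, CFC.posPart_zero]),
    hz (imaginaryPart G : H →L[ℂ] H)⁻ _ (by rw [him, CFC.negPart_zero])]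
  simp

/-! ### Weakly modulated operators and the residue sequence -/

/-- A bounded operator is strictly positive if it is positive and has dense range. -/
def IsStrictlyPositiveOp (V : H →L[ℂ] H) : Prop :=
  V.IsPositive ∧ DenseRange V

theorem IsStrictlyPositiveOp.ker_eq_bot {V : H →L[ℂ] H} (hV : IsStrictlyPositiveOp V) :
    LinearMap.ker (V : H →ₗ[ℂ] H) = ⊥ := by
  rw [LinearMap.ker_eq_bot']
  intro x hx
  refine hV.2.eq_zero_of_inner_left ℂ fun y => ?_
  have h : ⟪x, V y⟫_ℂ = ⟪V x, y⟫_ℂ := (hV.1.1 x y).symm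
  have hx' : V x = 0 := hx
  rw [h, hx', inner_zero_left]

/-- The operator `G V⁻¹`, with domain the range of the injective operator `V`. -/
noncomputable def compInverse (G V : H →L[ℂ] H) : H →ₗ.[ℂ] H :=
  (G : H →ₗ[ℂ] H).compPMap ((V : H →ₗ[ℂ] H).toPMap ⊤).inverse

/-- `G` is weakly modulated with respect to the strictly positive operator `V ∈ L^{p,∞}(H)`: the
densely defined operator `G V⁻¹` extends to a bounded operator in `L^{p/(p-1),∞}(H)`, where
`p/(p-1) = ∞` for `p = 1`. -/
def IsWeaklyModulated (p : ℝ≥0∞) (V G : H →L[ℂ] H) : Prop :=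
  ∃ A : H →L[ℂ] H, IsWeakSchatten (p / (p - 1)) A ∧
    compInverse G V ≤ (A : H →ₗ[ℂ] H).toPMap ⊤

theorem compInverse_le_iff {G V A : H →L[ℂ] H} (hV : IsStrictlyPositiveOp V) :
    compInverse G V ≤ (A : H →ₗ[ℂ] H).toPMap ⊤ ↔ ∀ x, A (V x) = G x := by
  have hker : LinearMap.ker ((V : H →ₗ[ℂ] H).toPMap ⊤).toFun = ⊥ := by
    rw [LinearMap.ker_eq_bot']
    intro x hx
    exact Subtype.ext ((LinearMap.ker_eq_bot'.1 hV.ker_eq_bot) x hx)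
  have hdom : ∀ x : H, V x ∈ ((V : H →ₗ[ℂ] H).toPMap ⊤).inverse.domain := fun x => by
    rw [LinearPMap.inverse_domain]
    exact ⟨⟨x, trivial⟩, rfl⟩
  have hval : ∀ x : H, ((V : H →ₗ[ℂ] H).toPMap ⊤).inverse ⟨V x, hdom x⟩ = x := fun x =>
    LinearPMap.inverse_apply_eq hker (x := ⟨x, trivial⟩) rfl
  constructor
  · intro h x
    have h1 := h.2 (x := ⟨V x, hdom x⟩) (y := ⟨V x, trivial⟩) rfl
    have h2 : compInverse G V ⟨V x, hdom x⟩ =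
        G (((V : H →ₗ[ℂ] H).toPMap ⊤).inverse ⟨V x, hdom x⟩) := rfl
    rw [h2, hval] at h1
    exact h1.symm
  · intro h
    refine ⟨fun _ _ => trivial, ?_⟩
    rintro ⟨y, hy⟩ ⟨z, hz⟩
    have hy' : y ∈ ((V : H →ₗ[ℂ] H).toPMap ⊤).inverse.domain := hy
    rw [LinearPMap.inverse_domain] at hy'
    obtain ⟨⟨x, -⟩, rfl⟩ := hy'
    intro hyz
    obtain rfl : V x = z := hyz
    have h1 : compInverse G V ⟨V x, hdom x⟩ = G x := by
      have h2 : compInverse G V ⟨V x, hdom x⟩ =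
          G (((V : H →ₗ[ℂ] H).toPMap ⊤).inverse ⟨V x, hdom x⟩) := rfl
      rw [h2, hval]
    exact h1.trans (h x).symm

/-- The residue sequence `Res(G)_N = (∑_{l=0}^N ⟨G e_l, e_l⟩) / log (N + 2)`, the inner product
`⟨x, y⟩` of the formula being linear in `x`, hence `⟪y, x⟫_ℂ` in Lean. -/
noncomputable def residueSeq (e : ℕ → H) (G : H →L[ℂ] H) (N : ℕ) : ℂ :=
  (∑ l ∈ Finset.range (N + 1), ⟪e l, G (e l)⟫_ℂ) / (Real.log ((N : ℝ) + 2) : ℂ)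

end DixmierTrace

/-! Both sides are compared with one quantity that is linear in `G`: the trace of the compression of
`G` to a finite-dimensional subspace `R`. For each `N`, let `R` contain the first `N + 1` vectors of
`e` and the first `N + 1` eigenvectors of each of the four positive parts of `G`, so that `dim R ≤ 5
(N + 1)`. Completing one of these families to an orthonormal basis of `R` splits the compressed
trace into the wanted partial sum and a remainder over `O(N)` orthonormal vectors orthogonal to that
family. All remainders are `O(1)`, so division by the logarithm makes them vanish.

For a positive part `B`, the remainder vectors satisfy `‖B f‖ ≤ μ_{N+1}(B) = O(1/N)`, and there are
`O(N)` of them (`exists_norm_compressedTrace_sub_sum_singularValue_le`).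

For `G = A V`, the remainder vectors lie in the range of the projection `P` that kills `e_0, …,
e_N`, so `G f = A (V P) f` with `‖V P‖ = O(N^{-1/p})`. Since `A` is in the weak ideal of the
conjugate exponent, its partial traces against a bounded operator over `O(N)` orthonormal vectors
grow at most like `N^{1/p}`, and the powers cancel (`exists_norm_sum_inner_comp_le`,
`exists_norm_compressedTrace_sub_sum_inner_le`). The Hölder-type bound rests on a dyadic
decomposition of `A` into differences of finite-rank approximants, each with partial trace at most
rank times norm.

Additivity of the Dixmier trace is not needed: the compressed trace supplies the linearity. -/

namespace DixmierTrace

variable {H : Type*} [NormedAddCommGroup H] [InnerProductSpace ℂ H]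

/-! ### Spectral theorem for compact positive operators -/

section SpectralSequence

/-- The spectral radius of a self-adjoint operator is its norm and is attained at some spectral
value; compactness makes a nonzero one an eigenvalue, and positivity makes it equal to `‖T‖`. -/
theorem exists_unit_eigenvector_norm {E : Type*} [NormedAddCommGroup E] [InnerProductSpace ℂ E]
    [CompleteSpace E] [Nontrivial E] {T : E →L[ℂ] E} (hc : IsCompactOperator T)
    (hT : T.IsPositive) : ∃ x, ‖x‖ = 1 ∧ T x = (‖T‖ : ℂ) • x := by
  rcases eq_or_ne T 0 with rfl | h0
  · obtain ⟨x, hx⟩ := exists_norm_eq E zero_le_one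
    exact ⟨x, hx, by simp⟩
  obtain ⟨μ, hμ, hnorm⟩ := spectrum.exists_nnnorm_eq_spectralRadius T
  rw [T.spectralRadius_eq_nnnorm hT.isSelfAdjoint] at hnorm
  have hnorm' : ‖μ‖ = ‖T‖ := congrArg NNReal.toReal (ENNReal.coe_injective hnorm)
  have hμ0 : μ ≠ 0 := by
    rintro rfl
    exact h0 (norm_eq_zero.1 (by simpa using hnorm'.symm))
  obtain ⟨y, hy⟩ := ((hc.hasEigenvalue_iff_mem_spectrum hμ0).2 hμ).exists_hasEigenvector
  have hy0 : y ≠ 0 := hy.2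
  have hTy : T y = μ • y := hy.apply_eq_smul
  have hμT : μ = ‖T‖ := by
    have h1 : 0 ≤ μ := spectrum_nonneg_of_nonneg ((ContinuousLinearMap.nonneg_iff_isPositive T).2 hT) hμ
    rw [← hnorm']
    exact Complex.eq_coe_norm_of_nonneg h1
  refine ⟨(‖y‖⁻¹ : ℂ) • y, by simp [norm_smul, hy0], ?_⟩
  rw [map_smul, hTy, hμT, smul_comm]

variable [CompleteSpace H]

/-- Self-adjointness makes `Mᗮ` invariant, and `t` is the norm of the restriction of `B` to it. This
is the greedy step that produces the eigenvectors in decreasing order. -/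
theorem exists_unit_eigenvector_orthogonal {B : H →L[ℂ] H} (hc : IsCompactOperator B)
    (hB : B.IsPositive) {M : Submodule ℂ H} (hM : ∀ x ∈ M, B x ∈ M) (hne : Mᗮ ≠ ⊥) :
    ∃ x ∈ Mᗮ, ‖x‖ = 1 ∧ ∃ t : ℝ, 0 ≤ t ∧ B x = (t : ℂ) • x ∧ ∀ y ∈ Mᗮ, ‖B y‖ ≤ t * ‖y‖ := by
  have hinv : ∀ x ∈ Mᗮ, B x ∈ Mᗮ := by
    intro x hx
    rw [Submodule.mem_orthogonal]
    intro y hy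
    have h : ⟪B y, x⟫_ℂ = ⟪y, B x⟫_ℂ := hB.1 y x
    rw [← h]
    exact Submodule.inner_right_of_mem_orthogonal (hM y hy) hx
  have hnt : Nontrivial Mᗮ := Submodule.nontrivial_iff_ne_bot.2 hne
  let S : Mᗮ →L[ℂ] Mᗮ := B.restrict hinv
  have hS : IsCompactOperator S := hc.restrict' hinv
  have hSpos : S.IsPositive := by
    refine ⟨fun x y => hB.1 x y, fun x => hB.2 x⟩
  obtain ⟨x, hx, hSx⟩ := exists_unit_eigenvector_norm hS hSpos
  refine ⟨x, x.2, hx, ‖S‖, S.opNorm_nonneg, congrArg Subtype.val hSx, fun y hy => ?_⟩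
  exact S.le_opNorm ⟨y, hy⟩

/-- The spectral theorem for a compact positive operator, in the form used for traces: an
orthonormal sequence of eigenvectors for the singular values, the operator being bounded by
`μ_n` off the first `n` of them. -/
theorem exists_orthonormal_singularValue {B : H →L[ℂ] H} (hc : IsCompactOperator B)
    (hB : B.IsPositive) (hinf : ¬ FiniteDimensional ℂ H) :
    ∃ g : ℕ → H, Orthonormal ℂ g ∧ (∀ k, B (g k) = (singularValue B k : ℂ) • g k) ∧
      ∀ n x, (∀ i < n, ⟪g i, x⟫_ℂ = 0) → ‖B x‖ ≤ singularValue B n * ‖x‖ := by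
  have key : ∀ M : {M : Submodule ℂ H // FiniteDimensional ℂ M ∧ ∀ x ∈ M, B x ∈ M},
      ∃ x ∈ M.1ᗮ, ‖x‖ = 1 ∧ ∃ t : ℝ, 0 ≤ t ∧ B x = (t : ℂ) • x ∧
        ∀ y ∈ M.1ᗮ, ‖B y‖ ≤ t * ‖y‖ := by
    rintro ⟨M, hfd, hM⟩
    refine exists_unit_eigenvector_orthogonal hc hB hM fun h => hinf ?_
    rw [Submodule.orthogonal_eq_bot_iff] at h
    subst h
    exact Module.Finite.equiv (Submodule.topEquiv (R := ℂ) (M := H))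
  choose next hperp hnorm t ht0 hteig htb using key
  let step : {M : Submodule ℂ H // FiniteDimensional ℂ M ∧ ∀ x ∈ M, B x ∈ M} →
      {M : Submodule ℂ H // FiniteDimensional ℂ M ∧ ∀ x ∈ M, B x ∈ M} := fun M =>
    ⟨M.1 ⊔ ℂ ∙ next M, by
      have := M.2.1
      refine ⟨inferInstance, fun x hx => ?_⟩
      obtain ⟨y, hy, z, hz, rfl⟩ := Submodule.mem_sup.1 hx
      obtain ⟨c, rfl⟩ := Submodule.mem_span_singleton.1 hz
      rw [map_add, map_smul, hteig]
      exact Submodule.add_mem_sup (M.2.2 y hy)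
        (Submodule.smul_mem _ _ (Submodule.smul_mem _ _ (Submodule.mem_span_singleton_self _)))⟩
  -- `M n` is the span of the first `n` chosen eigenvectors. Infinite dimension keeps `(M n)ᗮ`
  -- nonzero, so the choice never stops.
  let M : ℕ → {M : Submodule ℂ H // FiniteDimensional ℂ M ∧ ∀ x ∈ M, B x ∈ M} := fun n =>
    Nat.rec ⟨⊥, inferInstance, by simp⟩ (fun _ M => step M) n
  have hM1 : ∀ n, (M (n + 1)).1 = (M n).1 ⊔ ℂ ∙ next (M n) := fun n => rfl
  have hmono : Monotone fun n => (M n).1 := monotone_nat_of_le_succ fun n => by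
    rw [hM1]; exact le_sup_left
  let g : ℕ → H := fun n => next (M n)
  let s : ℕ → ℝ := fun n => t (M n)
  have hgmem : ∀ i n, i < n → g i ∈ (M n).1 := fun i n hin =>
    hmono (Nat.succ_le_of_lt hin) (by
      show g i ∈ (M (i + 1)).1
      rw [hM1]
      exact Submodule.mem_sup_right (Submodule.mem_span_singleton_self _))
  have horth : ∀ i n, i < n → ⟪g i, g n⟫_ℂ = 0 := fun i n hin =>
    Submodule.inner_right_of_mem_orthogonal (hgmem i n hin) (hperp (M n))
  have hg : Orthonormal ℂ g := by
    refine ⟨fun n => hnorm _, fun i j hij => ?_⟩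
    rcases lt_or_gt_of_ne hij with h | h
    · exact horth i j h
    · rw [← inner_conj_symm, horth j i h, map_zero]
  have hmemperp : ∀ n x, (∀ i < n, ⟪g i, x⟫_ℂ = 0) → x ∈ (M n).1ᗮ := by
    intro n x
    induction n with
    | zero => intro _; show x ∈ (⊥ : Submodule ℂ H)ᗮ; simp
    | succ n ih =>
      intro h
      rw [hM1, ← Submodule.inf_orthogonal]
      exact ⟨ih fun i hi => h i (by omega),
        Submodule.mem_orthogonal_singleton_iff_inner_right.2 (h n (by omega))⟩
  have heig : ∀ n, B (g n) = (s n : ℂ) • g n := fun n => hteig _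
  have hbd : ∀ n x, (∀ i < n, ⟪g i, x⟫_ℂ = 0) → ‖B x‖ ≤ s n * ‖x‖ := fun n x hx =>
    htb _ _ (hmemperp n x hx)
  have hs0 : ∀ n, 0 ≤ s n := fun n => ht0 _
  clear_value s g
  have hBg : ∀ n, ‖B (g n)‖ = s n := fun n => by
    rw [heig, norm_smul, hg.1 n, Complex.norm_real, Real.norm_of_nonneg (hs0 n), mul_one]
  have hanti : Antitone s := antitone_nat_of_succ_le fun n => by
    have h := hbd n (g (n + 1)) fun i hi => horth i (n + 1) (by omega)
    rwa [hBg, hg.1, mul_one] at h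
  -- For `m < n`, pairing with `g m` gives `‖B (g m) - B (g n)‖ ≥ s m`. If all `s m ≥ ε`, no
  -- subsequence of `B (g n)` is Cauchy, against compactness.
  have hlim : ∀ ε > 0, ∃ n, s n < ε := by
    intro ε hε
    by_contra! hcon
    obtain ⟨K, hK, hsub⟩ := hc.image_closedBall_subset_compact 1
    obtain ⟨y, -, φ, hφ, hy⟩ := hK.tendsto_subseq (x := fun n => B (g n))
      fun n => hsub ⟨g n, by simp [hg.1 n], rfl⟩
    obtain ⟨n, hn⟩ := Metric.cauchySeq_iff'.1 hy.cauchySeq ε hε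
    have h1 : dist (B (g (φ (n + 1)))) (B (g (φ n))) < ε := hn (n + 1) (by omega)
    have h2 : ⟪g (φ n), B (g (φ n)) - B (g (φ (n + 1)))⟫_ℂ = s (φ n) := by
      rw [heig, heig, inner_sub_right, inner_smul_right, inner_smul_right,
        horth _ _ (hφ (Nat.lt_succ_self n)), inner_self_eq_norm_sq_to_K, hg.1]
      simp
    have h3 := norm_inner_le_norm (𝕜 := ℂ) (g (φ n)) (B (g (φ n)) - B (g (φ (n + 1))))
    rw [h2, hg.1, Complex.norm_real, Real.norm_of_nonneg (hs0 _), one_mul, ← dist_eq_norm,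
      dist_comm] at h3
    exact absurd (hcon (φ n)) (not_le.2 (h3.trans_lt h1))
  have hsv : ∀ k, singularValue B k = s k := by
    refine singularValue_eq_of_eigenvectors hg hanti hs0 (fun k => ?_) fun x hx => ?_
    · rw [hB.isSelfAdjoint.star_eq, heig, map_smul, heig, smul_smul]
      push_cast
      rw [sq]
    -- A vector orthogonal to every `g i` has `‖B x‖ ≤ s n * ‖x‖` for all `n`, and `s` takes
    -- arbitrarily small values.
    · by_contra hne
      have hBx : 0 < ‖B x‖ := norm_pos_iff.2 hne
      obtain ⟨n, hn⟩ := hlim (‖B x‖ / (‖x‖ + 1)) (by positivity)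
      rw [lt_div_iff₀ (by positivity)] at hn
      have := hbd n x fun i _ => hx i
      nlinarith [hs0 n]
  exact ⟨g, hg, fun k => by rw [hsv, heig], fun n x hx => by rw [hsv]; exact hbd n x hx⟩

end SpectralSequence

/-! ### Compressed traces -/

section CompressedTrace

/-- The trace of the compression of `T` to a finite-dimensional subspace `R`. -/
noncomputable def compressedTrace (R : Submodule ℂ H) [FiniteDimensional ℂ R] (T : H →L[ℂ] H) : ℂ :=
  LinearMap.trace ℂ R ((R.orthogonalProjectionOnto ∘L T ∘L R.subtypeL : R →L[ℂ] R) : R →ₗ[ℂ] R)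

theorem compressedTrace_eq_sum (R : Submodule ℂ H) [FiniteDimensional ℂ R] (T : H →L[ℂ] H)
    {ι : Type*} [Fintype ι] (b : OrthonormalBasis ι ℂ R) :
    compressedTrace R T = ∑ i, ⟪(b i : H), T (b i)⟫_ℂ := by
  rw [compressedTrace, LinearMap.trace_eq_sum_inner _ b]
  refine Finset.sum_congr rfl fun i _ => ?_
  exact Submodule.inner_orthogonalProjectionOnto_eq_of_mem_left (b i) (T (b i))

theorem compressedTrace_add (R : Submodule ℂ H) [FiniteDimensional ℂ R] (S T : H →L[ℂ] H) :
    compressedTrace R (S + T) = compressedTrace R S + compressedTrace R T := by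
  simp [compressedTrace_eq_sum R _ (stdOrthonormalBasis ℂ R),
    Finset.sum_add_distrib]

theorem compressedTrace_smul (R : Submodule ℂ H) [FiniteDimensional ℂ R] (c : ℂ) (T : H →L[ℂ] H) :
    compressedTrace R (c • T) = c * compressedTrace R T := by
  simp [compressedTrace_eq_sum R _ (stdOrthonormalBasis ℂ R), Finset.mul_sum]

theorem compressedTrace_sub (R : Submodule ℂ H) [FiniteDimensional ℂ R] (S T : H →L[ℂ] H) :
    compressedTrace R (S - T) = compressedTrace R S - compressedTrace R T := by
  simp [compressedTrace_eq_sum R _ (stdOrthonormalBasis ℂ R),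
    Finset.sum_sub_distrib]

/-- Completing an orthonormal family of vectors of `R` to a basis splits the compressed trace. -/
theorem exists_compressedTrace_eq_add (R : Submodule ℂ H) [FiniteDimensional ℂ R] {e : ℕ → H}
    (he : Orthonormal ℂ e) {n : ℕ} (hR : ∀ i < n, e i ∈ R) :
    ∃ (m : ℕ) (f : Fin m → H), m ≤ Module.finrank ℂ R ∧ Orthonormal ℂ f ∧
      (∀ j, ∀ i < n, ⟪e i, f j⟫_ℂ = 0) ∧ ∀ T : H →L[ℂ] H, compressedTrace R T =
        ∑ i ∈ Finset.range n, ⟪e i, T (e i)⟫_ℂ + ∑ j, ⟪f j, T (f j)⟫_ℂ := by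
  let e' : Fin n → R := fun i => ⟨e i, hR i i.2⟩
  have he' : Orthonormal ℂ e' :=
    ⟨fun i => he.1 i, fun i j hij => he.2 (Fin.val_injective.ne hij)⟩
  have hcard : n ≤ Module.finrank ℂ R := by
    simpa using he'.linearIndependent.fintype_card_le_finrank
  obtain ⟨m, hm⟩ := Nat.exists_eq_add_of_le hcard
  -- The zeros are placeholders: the extension theorem keeps `w` only on the first `n` indices.
  let w : Fin (n + m) → R := Fin.addCases e' fun _ => 0
  obtain ⟨b, hb⟩ := Orthonormal.exists_orthonormalBasis_extension_of_card_eq (𝕜 := ℂ)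
    (ι := Fin (n + m)) (E := R) (by simpa using hm) (v := w) (s := Set.range (Fin.castAdd m)) (by
      constructor
      · rintro ⟨_, i, rfl⟩
        simpa [Set.domRestrict, w] using he'.1 i
      · rintro ⟨_, i, rfl⟩ ⟨_, j, rfl⟩ hij
        have : i ≠ j := fun h => hij (by rw [h])
        simpa [Set.domRestrict, w] using he'.2 this)
  have hbe : ∀ i : Fin n, (b (Fin.castAdd m i) : H) = e i := fun i => by
    rw [hb _ ⟨i, rfl⟩]
    simp [w, e']
  have hbo : Orthonormal ℂ fun i => (b i : H) :=
    b.orthonormal.comp_linearIsometry R.subtypeₗᵢ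
  refine ⟨m, fun j => b (Fin.natAdd n j), by omega, hbo.comp _ (Fin.natAdd_injective m n),
    fun j i hi => ?_, fun T => ?_⟩
  · have := hbo.2 (i := Fin.castAdd m ⟨i, hi⟩) (j := Fin.natAdd n j) (by
      intro h
      have := congrArg Fin.val h
      simp at this
      omega)
    simpa only [hbe] using this
  · rw [compressedTrace_eq_sum R T b, Fin.sum_univ_add, Finset.sum_range]
    simp only [hbe]

end CompressedTrace

/-! ### Bounds for partial traces -/

section TraceBounds

theorem norm_sum_inner_le_of_norm_le {m : ℕ} {f : Fin m → H} (hf : Orthonormal ℂ f)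
    (T : H →L[ℂ] H) {c : ℝ} (h : ∀ j, ‖T (f j)‖ ≤ c) :
    ‖∑ j, ⟪f j, T (f j)⟫_ℂ‖ ≤ m * c := by
  have h1 : ∀ j ∈ Finset.univ, ‖⟪f j, T (f j)⟫_ℂ‖ ≤ c := fun j _ => by
    have := norm_inner_le_norm (𝕜 := ℂ) (f j) (T (f j))
    rw [hf.1, one_mul] at this
    exact this.trans (h j)
  simpa using norm_sum_le_of_le Finset.univ h1

/-- Cauchy–Schwarz, then Bessel for `x` and for `y`; the bound does not depend on `m`. -/
theorem norm_sum_inner_mul_inner_le {m : ℕ} {f : Fin m → H} (hf : Orthonormal ℂ f) (x y : H) :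
    ‖∑ i, ⟪x, f i⟫_ℂ * ⟪f i, y⟫_ℂ‖ ≤ ‖x‖ * ‖y‖ := by
  refine le_of_sq_le_sq ?_ (by positivity)
  calc ‖∑ i, ⟪x, f i⟫_ℂ * ⟪f i, y⟫_ℂ‖ ^ 2
      ≤ (∑ i, ‖⟪f i, x⟫_ℂ‖ * ‖⟪f i, y⟫_ℂ‖) ^ 2 := by
        refine pow_le_pow_left₀ (norm_nonneg _) ((norm_sum_le _ _).trans (le_of_eq ?_)) 2
        exact Finset.sum_congr rfl fun i _ => by rw [norm_mul, norm_inner_symm]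
    _ ≤ (∑ i, ‖⟪f i, x⟫_ℂ‖ ^ 2) * ∑ i, ‖⟪f i, y⟫_ℂ‖ ^ 2 := Finset.sum_mul_sq_le_sq_mul_sq _ _ _
    _ ≤ ‖x‖ ^ 2 * ‖y‖ ^ 2 := by
        have h1 := hf.sum_inner_products_le (x := x) (s := Finset.univ)
        have h2 := hf.sum_inner_products_le (x := y) (s := Finset.univ)
        gcongr
    _ = (‖x‖ * ‖y‖) ^ 2 := by ring

variable [CompleteSpace H]

/-- In an orthonormal basis `h` of its range, `K` is a sum of at most `r` rank-one operators `⟪K*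
h_j, ·⟫ h_j`, each contributing at most `‖K* h_j‖ ≤ ‖K‖` however many vectors `f` has. -/
theorem norm_sum_inner_le_of_rank_le {m : ℕ} {f : Fin m → H} (hf : Orthonormal ℂ f)
    {K : H →L[ℂ] H} {r : ℕ} (hK : LinearMap.rank (K : H →ₗ[ℂ] H) ≤ (r : Cardinal)) :
    ‖∑ i, ⟪f i, K (f i)⟫_ℂ‖ ≤ r * ‖K‖ := by
  have hfd := finiteDimensional_range_of_rank_le hK
  let R := LinearMap.range (K : H →ₗ[ℂ] H)
  let h := stdOrthonormalBasis ℂ R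
  have hr : Module.finrank ℂ R ≤ r := Module.finrank_le_of_rank_le hK
  have hexp : ∀ x, K x = ∑ j, ⟪star K (h j : H), x⟫_ℂ • (h j : H) := fun x => by
    have h1 := congrArg (Subtype.val : R → H) (h.sum_repr' ⟨K x, x, rfl⟩)
    rw [Submodule.coe_sum] at h1
    refine h1.symm.trans (Finset.sum_congr rfl fun j _ => ?_)
    rw [ContinuousLinearMap.star_eq_adjoint, ContinuousLinearMap.adjoint_inner_left]
    rfl
  have hsum : ∑ i, ⟪f i, K (f i)⟫_ℂ =
      ∑ j, ∑ i, ⟪star K (h j : H), f i⟫_ℂ * ⟪f i, (h j : H)⟫_ℂ := by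
    rw [Finset.sum_comm]
    refine Finset.sum_congr rfl fun i _ => ?_
    rw [hexp (f i), inner_sum]
    exact Finset.sum_congr rfl fun j _ => inner_smul_right _ _ _
  have hj : ∀ j ∈ Finset.univ,
      ‖∑ i, ⟪star K (h j : H), f i⟫_ℂ * ⟪f i, (h j : H)⟫_ℂ‖ ≤ ‖K‖ := fun j _ => by
    have h1 : ‖(h j : H)‖ = 1 := h.orthonormal.1 j
    refine (norm_sum_inner_mul_inner_le hf _ _).trans ?_
    rw [h1, mul_one, ← norm_star K]
    simpa [h1] using (star K).le_opNorm (h j : H)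
  rw [hsum]
  refine (norm_sum_le_of_le Finset.univ hj).trans ?_
  rw [Finset.sum_const, Finset.card_univ, Fintype.card_fin, nsmul_eq_mul]
  gcongr

/-- The Hölder-type bound for `A ∈ L^{1/s,∞}(H)`: the partial traces of `A W` over orthonormal
families of size `O(2^J)` are `O(2^{J(1-s)} ‖W‖)`. -/
theorem exists_norm_sum_inner_comp_le {A : H →L[ℂ] H} {C s : ℝ} (hs0 : 0 ≤ s) (hs1 : s < 1)
    (hA : ∀ k : ℕ, singularValue A k ≤ C * (1 + (k : ℝ)) ^ (-s)) (c : ℕ) :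
    ∃ K : ℝ, 0 ≤ K ∧ ∀ (J m : ℕ) (f : Fin m → H) (W : H →L[ℂ] H), m ≤ c * 2 ^ J →
      Orthonormal ℂ f →
      ‖∑ i, ⟪f i, A (W (f i))⟫_ℂ‖ ≤ K * (2 * (2 : ℝ) ^ (-s)) ^ J * ‖W‖ := by
  have hC0 : 0 ≤ C := by simpa using (singularValue_nonneg A 0).trans (hA 0)
  set x : ℝ := (2 : ℝ) ^ (-s) with hx
  have hx0 : 0 < x := by positivity
  have hx1 : x ≤ 1 := Real.rpow_le_one_of_one_le_of_nonpos (by norm_num) (by linarith)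
  -- Here `s < 1` is essential: the dyadic pieces grow geometrically with ratio `2 * x`, so their
  -- sum is comparable to the last term.
  have hx2 : 1 < 2 * x := by
    have h : (2 : ℝ) ^ (-1 : ℝ) < 2 ^ (-s) := Real.rpow_lt_rpow_of_exponent_lt (by norm_num) (by linarith)
    rw [Real.rpow_neg_one] at h
    linarith
  -- Near-optimal approximants of rank at most `2 ^ j`; the slack `ε = x ^ j` turns `C` into `C +
  -- 1`.
  have hF : ∀ j : ℕ, ∃ F : H →L[ℂ] H, LinearMap.rank (F : H →ₗ[ℂ] H) ≤ ((2 ^ j : ℕ) : Cardinal) ∧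
      ‖A - F‖ ≤ (C + 1) * x ^ j := by
    intro j
    obtain ⟨F, hF, hlt⟩ := exists_norm_sub_lt A (2 ^ j) (ε := x ^ j) (by positivity)
    refine ⟨F, hF, hlt.le.trans ?_⟩
    have h1 : (1 + ((2 ^ j : ℕ) : ℝ)) ^ (-s) ≤ x ^ j := by
      have h2 : x ^ j = ((2 : ℝ) ^ j) ^ (-s) := by
        rw [hx, ← Real.rpow_natCast, ← Real.rpow_natCast, ← Real.rpow_mul (by norm_num),
          ← Real.rpow_mul (by norm_num), mul_comm]
      rw [h2]
      exact Real.rpow_le_rpow_of_nonpos (by positivity) (by push_cast; linarith) (by linarith)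
    have h3 := (hA (2 ^ j)).trans (mul_le_mul_of_nonneg_left h1 hC0)
    linarith
  choose F hFr hFn using hF
  set D := C + 1
  have hD : 0 ≤ D := by positivity
  -- `K` is chosen so that `K + 6 * D ≤ K * (2 * x)`, which closes the induction on `J`; `‖F 0‖`
  -- covers `J = 0`. The `6 * D` is `3 * (2 * D)`, from the rank `3 * 2 ^ J` and the norm `2 * D * x
  -- ^ J` of `F (J + 1) - F J`.
  set K := ‖F 0‖ + 6 * D / (2 * x - 1) with hK
  have hK0 : 0 ≤ K := by
    have : 0 < 2 * x - 1 := by linarith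
    positivity
  have hKD : K + 6 * D ≤ K * (2 * x) := by
    have h1 : 0 < 2 * x - 1 := by linarith
    have h2 : 6 * D / (2 * x - 1) * (2 * x - 1) = 6 * D := div_mul_cancel₀ _ h1.ne'
    have h3 : 0 ≤ ‖F 0‖ * (2 * x - 1) := by positivity
    have h4 : K * (2 * x - 1) = ‖F 0‖ * (2 * x - 1) + 6 * D := by rw [hK, add_mul, h2]
    linarith
  have hrank : ∀ (m : ℕ) (f : Fin m → H) (G W : H →L[ℂ] H) (r : ℕ), Orthonormal ℂ f →
      LinearMap.rank (G : H →ₗ[ℂ] H) ≤ (r : Cardinal) →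
      ‖∑ i, ⟪f i, G (W (f i))⟫_ℂ‖ ≤ r * (‖G‖ * ‖W‖) := by
    intro m f G W r hf hG
    have h1 : LinearMap.rank ((G ∘L W : H →L[ℂ] H) : H →ₗ[ℂ] H) ≤ (r : Cardinal) :=
      (LinearMap.rank_comp_le_left (W : H →ₗ[ℂ] H) (G : H →ₗ[ℂ] H)).trans hG
    refine (norm_sum_inner_le_of_rank_le hf h1).trans ?_
    gcongr
    exact G.opNorm_comp_le W
  have hFJ : ∀ (J m : ℕ) (f : Fin m → H) (W : H →L[ℂ] H), Orthonormal ℂ f →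
      ‖∑ i, ⟪f i, F J (W (f i))⟫_ℂ‖ ≤ K * (2 * x) ^ J * ‖W‖ := by
    intro J m f W hf
    induction J with
    | zero =>
      have h1 := hrank m f (F 0) W (2 ^ 0) hf (hFr 0)
      have h2 : ‖F 0‖ ≤ K := by
        have : 0 < 2 * x - 1 := by linarith
        rw [hK]
        linarith [show 0 ≤ 6 * D / (2 * x - 1) by positivity]
      refine h1.trans ?_
      simp only [pow_zero, Nat.cast_one, one_mul, mul_one]
      gcongr
    | succ J ih =>
      have h1 : LinearMap.rank ((F (J + 1) - F J : H →L[ℂ] H) : H →ₗ[ℂ] H) ≤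
          ((3 * 2 ^ J : ℕ) : Cardinal) := by
        have h2 : ((F (J + 1) - F J : H →L[ℂ] H) : H →ₗ[ℂ] H) =
            (F (J + 1) : H →ₗ[ℂ] H) + (-LinearMap.id) ∘ₗ (F J : H →ₗ[ℂ] H) := by
          ext y; simp [sub_eq_add_neg]
        rw [h2]
        refine (LinearMap.rank_add_le _ _).trans ((add_le_add (hFr (J + 1))
          ((LinearMap.rank_comp_le_right _ _).trans (hFr J))).trans ?_)
        exact_mod_cast (by rw [pow_succ]; omega : 2 ^ (J + 1) + 2 ^ J ≤ 3 * 2 ^ J)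
      have h3 : ‖F (J + 1) - F J‖ ≤ 2 * D * x ^ J := by
        have h4 : F (J + 1) - F J = (A - F J) - (A - F (J + 1)) := by abel
        have h5 : x ^ (J + 1) ≤ x ^ J := pow_le_pow_of_le_one hx0.le hx1 (Nat.le_succ J)
        have h6 := mul_le_mul_of_nonneg_left h5 hD
        rw [h4]
        linarith [norm_sub_le (A - F J) (A - F (J + 1)), hFn J, hFn (J + 1)]
      have h7 := hrank m f _ W _ hf h1
      have h8 : ∑ i, ⟪f i, F (J + 1) (W (f i))⟫_ℂ =
          ∑ i, ⟪f i, F J (W (f i))⟫_ℂ + ∑ i, ⟪f i, (F (J + 1) - F J) (W (f i))⟫_ℂ := by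
        rw [← Finset.sum_add_distrib]
        refine Finset.sum_congr rfl fun i _ => ?_
        rw [← inner_add_right]
        simp
      rw [h8]
      calc _ ≤ _ := norm_add_le _ _
        _ ≤ K * (2 * x) ^ J * ‖W‖ + (3 * 2 ^ J : ℕ) * ((2 * D * x ^ J) * ‖W‖) := by
            refine add_le_add ih (h7.trans ?_)
            gcongr
        _ = (K + 6 * D) * ((2 * x) ^ J * ‖W‖) := by push_cast; rw [mul_pow]; ring
        _ ≤ K * (2 * x) * ((2 * x) ^ J * ‖W‖) := by gcongr
        _ = _ := by ring
  -- `K` bounds the part through `F J`; `c * D` comes from `A - F J`, of norm at most `D * x ^ J`,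
  -- summed over `m ≤ c * 2 ^ J` unit vectors.
  refine ⟨K + c * D, by positivity, fun J m f W hm hf => ?_⟩
  have h1 : ∑ i, ⟪f i, A (W (f i))⟫_ℂ =
      ∑ i, ⟪f i, F J (W (f i))⟫_ℂ + ∑ i, ⟪f i, ((A - F J) ∘L W) (f i)⟫_ℂ := by
    rw [← Finset.sum_add_distrib]
    refine Finset.sum_congr rfl fun i _ => ?_
    rw [← inner_add_right]
    simp
  have h2 : ‖∑ i, ⟪f i, ((A - F J) ∘L W) (f i)⟫_ℂ‖ ≤ m * (D * x ^ J * ‖W‖) := by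
    refine norm_sum_inner_le_of_norm_le hf _ fun j => ?_
    have h3 := ((A - F J) ∘L W).le_opNorm (f j)
    rw [hf.1, mul_one] at h3
    refine h3.trans (((A - F J).opNorm_comp_le W).trans ?_)
    exact mul_le_mul_of_nonneg_right (hFn J) (norm_nonneg _)
  have h4 : (m : ℝ) ≤ c * 2 ^ J := by exact_mod_cast hm
  rw [h1]
  calc _ ≤ _ := norm_add_le _ _
    _ ≤ K * (2 * x) ^ J * ‖W‖ + c * 2 ^ J * (D * x ^ J * ‖W‖) := by
        refine add_le_add (hFJ J m f W hf) (h2.trans ?_)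
        gcongr
    _ = _ := by rw [mul_pow]; ring

end TraceBounds

/-! ### Compressed traces agree with partial sums up to `O(1)` -/

section TraceAsymptotics

theorem hasSum_norm_inner_sq {ι : Type*} (e : HilbertBasis ι ℂ H) (x : H) :
    HasSum (fun i => ‖⟪e i, x⟫_ℂ‖ ^ 2) (‖x‖ ^ 2) := by
  have h := e.hasSum_inner_mul_inner x x
  rw [inner_self_eq_norm_sq_to_K] at h
  refine Complex.hasSum_ofReal.1 ?_
  convert! h using 1
  · ext i
    rw [← inner_conj_symm x (e i), Complex.conj_mul']
    push_cast
    rfl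
  · push_cast
    rfl

variable [CompleteSpace H]

/-- Parseval: the coefficients of `V x` are `v i * ⟪e i, x⟫_ℂ`, and only those with `i ≥ n` survive.
-/
theorem norm_map_le_of_hilbertBasis {V : H →L[ℂ] H} (hV : IsSelfAdjoint V)
    (e : HilbertBasis ℕ ℂ H) {v : ℕ → ℝ} (hv : Antitone v) (hv0 : ∀ l, 0 ≤ v l)
    (he : ∀ l, V (e l) = (v l : ℂ) • e l) {n : ℕ} {x : H} (hx : ∀ i < n, ⟪e i, x⟫_ℂ = 0) :
    ‖V x‖ ≤ v n * ‖x‖ := by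
  refine le_of_sq_le_sq ?_ (mul_nonneg (hv0 n) (norm_nonneg x))
  rw [mul_pow]
  refine hasSum_le (fun i => ?_) (hasSum_norm_inner_sq e (V x))
    ((hasSum_norm_inner_sq e x).mul_left (v n ^ 2))
  have h1 : ⟪e i, V x⟫_ℂ = v i * ⟪e i, x⟫_ℂ := by
    have h2 : ⟪V (e i), x⟫_ℂ = ⟪e i, V x⟫_ℂ := hV.isSymmetric (e i) x
    rw [← h2, he, inner_smul_left, Complex.conj_ofReal]
  rw [h1, norm_mul, mul_pow, Complex.norm_real, Real.norm_of_nonneg (hv0 i)]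
  rcases lt_or_ge i n with hi | hi
  · simp [hx i hi]
  · have := hv hi
    have := hv0 i
    gcongr

theorem singularValue_eq_of_hilbertBasis {V : H →L[ℂ] H} (hV : IsSelfAdjoint V)
    (e : HilbertBasis ℕ ℂ H) {v : ℕ → ℝ} (hv : Antitone v) (hv0 : ∀ l, 0 ≤ v l)
    (he : ∀ l, V (e l) = (v l : ℂ) • e l) (k : ℕ) : singularValue V k = v k := by
  refine singularValue_eq_of_eigenvectors e.orthonormal hv hv0 (fun k => ?_) (fun x hx => ?_) k
  · rw [hV.star_eq, he, map_smul, he, smul_smul]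
    push_cast
    rw [sq]
  · have h := hasSum_norm_inner_sq e x
    simp only [hx, norm_zero, ne_eq, OfNat.ofNat_ne_zero, not_false_eq_true, zero_pow] at h
    have h0 := h.unique hasSum_zero
    rw [norm_eq_zero.1 (pow_eq_zero_iff two_ne_zero |>.1 h0), map_zero]

/-- For `B ≥ 0` in `L^{1,∞}(H)`, the compressed traces over subspaces of dimension `O(N)` that
contain the first `N + 1` eigenvectors differ from `∑_{k=0}^N μ_k(B)` by a bounded amount. -/
theorem exists_norm_compressedTrace_sub_sum_singularValue_le {B : H →L[ℂ] H} (hB : 0 ≤ B)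
    (hB1 : IsWeakSchatten 1 B) (hinf : ¬ FiniteDimensional ℂ H) (c : ℕ) :
    ∃ (g : ℕ → H) (K : ℝ), ∀ (N : ℕ) (R : Submodule ℂ H) [FiniteDimensional ℂ R],
      (∀ i < N + 1, g i ∈ R) → Module.finrank ℂ R ≤ c * (N + 1) →
      ‖compressedTrace R B - ((∑ k ∈ Finset.range (N + 1), singularValue B k : ℝ) : ℂ)‖ ≤ K := by
  have hpos := (ContinuousLinearMap.nonneg_iff_isPositive B).1 hB
  obtain ⟨g, hg, hBg, hbd⟩ :=
    exists_orthonormal_singularValue (hB1.1 ENNReal.one_ne_top) hpos hinf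
  obtain ⟨-, C, hC⟩ := hB1
  have hC0 : 0 ≤ C := by simpa using (singularValue_nonneg B 0).trans (hC 0)
  refine ⟨g, c * C, fun N R _ hR hcard => ?_⟩
  obtain ⟨m, f, hm, hf, hperp, htr⟩ := exists_compressedTrace_eq_add R hg hR
  have h1 : ∑ i ∈ Finset.range (N + 1), ⟪g i, B (g i)⟫_ℂ =
      ((∑ k ∈ Finset.range (N + 1), singularValue B k : ℝ) : ℂ) := by
    push_cast
    refine Finset.sum_congr rfl fun i _ => ?_
    rw [hBg, inner_smul_right, inner_self_eq_norm_sq_to_K, hg.1]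
    simp
  have h2 : singularValue B (N + 1) ≤ C * ((N : ℝ) + 1)⁻¹ := by
    refine (hC (N + 1)).trans (mul_le_mul_of_nonneg_left ?_ hC0)
    simp only [inv_one, ENNReal.toReal_one, Real.rpow_neg_one]
    refine inv_anti₀ (by positivity) ?_
    push_cast
    linarith
  have h3 : ‖∑ j, ⟪f j, B (f j)⟫_ℂ‖ ≤ m * (C * ((N : ℝ) + 1)⁻¹) :=
    norm_sum_inner_le_of_norm_le hf B fun j => by
      have h4 := hbd (N + 1) (f j) (hperp j)
      rw [hf.1, mul_one] at h4
      exact h4.trans h2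
  rw [htr, h1, add_sub_cancel_left]
  refine h3.trans ?_
  have h5 : (m : ℝ) ≤ c * (N + 1) := by exact_mod_cast hm.trans hcard
  calc (m : ℝ) * (C * ((N : ℝ) + 1)⁻¹) ≤ c * (N + 1) * (C * ((N : ℝ) + 1)⁻¹) := by gcongr
    _ = c * C := by field_simp

/-- Includes `p = 1`, where the conjugate exponent is `∞` and both sides are `0`. -/
theorem toReal_inv_conjExponent {p : ℝ≥0∞} (hp : 1 ≤ p) (hp' : p ≠ ∞) :
    ((p / (p - 1))⁻¹).toReal = 1 - (p⁻¹).toReal := by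
  have hp0 : p ≠ 0 := (zero_lt_one.trans_le hp).ne'
  have h1 : p.toReal ≠ 0 := ENNReal.toReal_ne_zero.2 ⟨hp0, hp'⟩
  rw [ENNReal.inv_div (Or.inr hp') (Or.inr hp0), ENNReal.toReal_div,
    ENNReal.toReal_sub_of_le hp hp', ENNReal.toReal_inv, ENNReal.toReal_one, sub_div,
    div_self h1, one_div]

/-- For `G` weakly `V`-modulated, the compressed traces over subspaces of dimension `O(N)` that
contain the first `N + 1` eigenvectors of `V` differ from `∑_{l=0}^N ⟨G e_l, e_l⟩` by a bounded
amount. -/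
theorem exists_norm_compressedTrace_sub_sum_inner_le {p : ℝ≥0∞} (hp : 1 ≤ p) (hp' : p ≠ ∞)
    {V G : H →L[ℂ] H} (hV : IsStrictlyPositiveOp V) (hVp : IsWeakSchatten p V)
    (e : HilbertBasis ℕ ℂ H) {v : ℕ → ℝ} (hv : Antitone v)
    (he : ∀ l, V (e l) = (v l : ℂ) • e l) (hGV : IsWeaklyModulated p V G) (c : ℕ) :
    ∃ K : ℝ, ∀ (N : ℕ) (R : Submodule ℂ H) [FiniteDimensional ℂ R],
      (∀ i < N + 1, e i ∈ R) → Module.finrank ℂ R ≤ c * (N + 1) →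
      ‖compressedTrace R G - ∑ l ∈ Finset.range (N + 1), ⟪e l, G (e l)⟫_ℂ‖ ≤ K := by
  have hsa : IsSelfAdjoint V := hV.1.isSelfAdjoint
  have hv0 : ∀ l, 0 ≤ v l := fun l => by
    have h := hV.1.inner_nonneg_right (e l)
    rw [he, inner_smul_right, inner_self_eq_norm_sq_to_K, e.orthonormal.1] at h
    simpa using h
  obtain ⟨A, ⟨-, CA, hA⟩, hAG⟩ := hGV
  rw [compInverse_le_iff hV] at hAG
  obtain ⟨-, CV, hCV⟩ := hVp
  have hCV0 : 0 ≤ CV := by simpa using (singularValue_nonneg V 0).trans (hCV 0)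
  simp only [singularValue_eq_of_hilbertBasis hsa e hv hv0 he] at hCV
  rw [toReal_inv_conjExponent hp hp'] at hA
  set t := (p⁻¹).toReal with ht
  have ht0 : 0 < t := ENNReal.toReal_pos (ENNReal.inv_ne_zero.2 hp')
    (ENNReal.inv_ne_top.2 (zero_lt_one.trans_le hp).ne')
  have ht1 : t ≤ 1 := by
    have := ENNReal.toReal_mono ENNReal.one_ne_top (ENNReal.inv_le_one.2 hp)
    simpa [ht] using this
  -- Applied with `s = 1 - t`, so `s < 1` is `t > 0`, i.e. `p ≠ ∞`. The factor `2 * c` allows for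
  -- rounding `N + 1` down to a power of two.
  obtain ⟨K, hK0, hK⟩ :=
    exists_norm_sum_inner_comp_le (by linarith) (by linarith) hA (2 * c)
  refine ⟨K * CV, fun N R _ hR hcard => ?_⟩
  obtain ⟨m, f, hm, hf, hperp, htr⟩ := exists_compressedTrace_eq_add R e.orthonormal hR
  rw [htr, add_sub_cancel_left]
  let M : Submodule ℂ H := Submodule.span ℂ (e '' (Finset.range (N + 1) : Set ℕ))
  have : FiniteDimensional ℂ M :=
    FiniteDimensional.span_of_finite ℂ ((Finset.range (N + 1)).finite_toSet.image e)
  -- On the remainder vectors `A W` agrees with `G`, while the projection lowers the norm of `V` to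
  -- `v (N + 1)`.
  let W : H →L[ℂ] H := V ∘L Mᗮ.starProjection
  have hfM : ∀ j, f j ∈ Mᗮ := fun j => by
    refine (Submodule.mem_orthogonal _ _).2 fun u hu => ?_
    refine Submodule.span_induction (p := fun u _ => ⟪u, f j⟫_ℂ = 0) ?_ (by simp)
      (fun a b _ _ ha hb => by rw [inner_add_left, ha, hb, add_zero])
      (fun a b _ hb => by rw [inner_smul_left, hb, mul_zero]) hu
    rintro _ ⟨i, hi, rfl⟩
    exact hperp j i (by simpa using hi)
  have hWf : ∀ j, A (W (f j)) = G (f j) := fun j => by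
    have h1 : Mᗮ.starProjection (f j) = f j := Submodule.starProjection_eq_self_iff.2 (hfM j)
    show A (V (Mᗮ.starProjection (f j))) = G (f j)
    rw [h1, hAG]
  have hWn : ‖W‖ ≤ v (N + 1) := by
    refine ContinuousLinearMap.opNorm_le_bound _ (hv0 _) fun x => ?_
    refine (norm_map_le_of_hilbertBasis hsa e hv hv0 he (n := N + 1) fun i hi => ?_).trans
      (mul_le_mul_of_nonneg_left (Mᗮ.norm_starProjection_apply_le x) (hv0 _))
    exact Submodule.inner_right_of_mem_orthogonal
      (Submodule.subset_span ⟨i, by simpa using hi, rfl⟩ : e i ∈ M)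
      (Mᗮ.starProjection_apply_mem x)
  set J := Nat.log 2 (N + 1) with hJ
  have hJ1 : 2 ^ J ≤ N + 1 := Nat.pow_log_le_self 2 (by omega)
  have hJ2 : N + 1 ≤ 2 * 2 ^ J := by
    have := Nat.lt_pow_succ_log_self (b := 2) (by norm_num) (N + 1)
    rw [← hJ, pow_succ] at this
    omega
  have hmJ : m ≤ 2 * c * 2 ^ J := calc
    m ≤ c * (N + 1) := hm.trans hcard
    _ ≤ c * (2 * 2 ^ J) := Nat.mul_le_mul_left c hJ2
    _ = _ := by ring
  have hmain := hK J m f W hmJ hf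
  simp only [hWf] at hmain
  have hvN : v (N + 1) ≤ CV * ((2 : ℝ) ^ J) ^ (-t) := by
    refine (hCV (N + 1)).trans (mul_le_mul_of_nonneg_left ?_ hCV0)
    refine Real.rpow_le_rpow_of_nonpos (by positivity) ?_ (by linarith)
    have : (2 : ℝ) ^ J ≤ N + 1 := by exact_mod_cast hJ1
    push_cast
    linarith
  -- The growth `2 ^ (t J)` of the partial traces of `A` exactly cancels the decay of `‖W‖`.
  have hx : (2 * (2 : ℝ) ^ (-(1 - t))) ^ J * ((2 : ℝ) ^ J) ^ (-t) = 1 := by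
    have h1 : 2 * (2 : ℝ) ^ (-(1 - t)) = 2 ^ t := by
      rw [← Real.rpow_one_add' (by norm_num) (by linarith)]
      congr 1
      ring
    rw [h1, ← Real.rpow_natCast, ← Real.rpow_natCast, ← Real.rpow_mul (by norm_num),
      ← Real.rpow_mul (by norm_num), ← Real.rpow_add (by norm_num)]
    ring_nf
    simp
  calc _ ≤ _ := hmain
    _ ≤ K * (2 * (2 : ℝ) ^ (-(1 - t))) ^ J * (CV * ((2 : ℝ) ^ J) ^ (-t)) := by
        gcongr
        exact hWn.trans hvN
    _ = K * CV * ((2 * (2 : ℝ) ^ (-(1 - t))) ^ J * ((2 : ℝ) ^ J) ^ (-t)) := by ring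
    _ = K * CV := by rw [hx, mul_one]

end TraceAsymptotics

/-! ### Normalisation by logarithms and extended limits -/

section Limits

/-- Reconciles the two normalisations: replacing `log N` by `log (N + 2)` costs the bounded `S N /
log N` times the bounded difference of the logarithms, all over `log (N + 2)`. -/
theorem tendsto_div_log_sub_div_log {S T : ℕ → ℂ} {K d : ℝ} (hST : ∀ N, ‖S N - T N‖ ≤ K)
    (hd : ∀ N, ‖S N / (Real.log N : ℂ)‖ ≤ d) :
    Tendsto (fun N : ℕ => T N / (Real.log ((N : ℝ) + 2) : ℂ) - S N / (Real.log N : ℂ))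
      atTop (𝓝 0) := by
  have hd0 : 0 ≤ d := (norm_nonneg _).trans (hd 0)
  have hlog : Tendsto (fun N : ℕ => Real.log ((N : ℝ) + 2)) atTop atTop :=
    Real.tendsto_log_atTop.comp (tendsto_atTop_add_const_right _ _ tendsto_natCast_atTop_atTop)
  refine squeeze_zero_norm' (a := fun N : ℕ => (K + d * Real.log 3) / Real.log ((N : ℝ) + 2)) ?_
    (hlog.const_div_atTop _)
  -- From `N = 2` on, `log N` is positive and `N + 2 ≤ 3 * N`, whence the constant `log 3`.
  filter_upwards [eventually_ge_atTop 2] with N hN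
  have hN' : (2 : ℝ) ≤ N := by exact_mod_cast hN
  have hl0 : 0 < Real.log N := Real.log_pos (by linarith)
  have hl : Real.log N ≤ Real.log ((N : ℝ) + 2) := Real.log_le_log (by linarith) (by linarith)
  have hl2 : 0 < Real.log ((N : ℝ) + 2) := hl0.trans_le hl
  have hl3 : Real.log ((N : ℝ) + 2) - Real.log N ≤ Real.log 3 := by
    have h1 : Real.log ((N : ℝ) + 2) ≤ Real.log (3 * N) :=
      Real.log_le_log (by linarith) (by linarith)
    rw [Real.log_mul (by norm_num) (by linarith)] at h1
    linarith
  have hc0 : (Real.log N : ℂ) ≠ 0 := by exact_mod_cast hl0.ne'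
  have hc2 : (Real.log ((N : ℝ) + 2) : ℂ) ≠ 0 := by exact_mod_cast hl2.ne'
  have hid : T N / (Real.log ((N : ℝ) + 2) : ℂ) - S N / (Real.log N : ℂ) =
      -((S N - T N) + S N / (Real.log N : ℂ) *
        ((Real.log ((N : ℝ) + 2) - Real.log N : ℝ) : ℂ)) / (Real.log ((N : ℝ) + 2) : ℂ) := by
    rw [Complex.ofReal_sub]
    field_simp
    ring
  rw [hid, norm_div, norm_neg, Complex.norm_real, Real.norm_of_nonneg hl2.le]
  gcongr
  refine (norm_add_le _ _).trans (add_le_add (hST N) ?_)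
  rw [norm_mul, Complex.norm_real, Real.norm_of_nonneg (by linarith)]
  exact mul_le_mul (hd N) hl3 (by linarith) hd0

theorem memℓp_infty_of_tendsto {c : ℕ → ℂ} {a : ℂ} (h : Tendsto c atTop (𝓝 a)) :
    Memℓp c ∞ := by
  refine memℓp_infty ?_
  exact h.norm.bddAbove_range

/-- Boundedness of `d` is part of the conclusion: it is a bounded sequence plus a null one. Applied
to the residue sequence, this yields both claims at once. -/
theorem IsExtendedLimit.eq_of_tendsto_sub {ω : lp (fun _ : ℕ => ℂ) ∞ →L[ℂ] ℂ}
    (hω : IsExtendedLimit ω) (c : lp (fun _ : ℕ => ℂ) ∞) {d : ℕ → ℂ}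
    (h : Tendsto (fun n => d n - c n) atTop (𝓝 0)) :
    ∃ hd : Memℓp d ∞, ω c = ω ⟨d, hd⟩ := by
  have hd : Memℓp d ∞ := by
    have h1 := (memℓp_infty_of_tendsto h).add c.2
    convert! h1 using 1
    ext n
    exact (sub_add_cancel (d n) (c n)).symm
  refine ⟨hd, ?_⟩
  have h2 := hω.singular ((⟨d, hd⟩ : lp (fun _ : ℕ => ℂ) ∞) - c) h
  rw [map_sub, sub_eq_zero] at h2
  exact h2.symm

end Limits

/-! ### Comparison of the Dixmier sums with the diagonal sums -/

section Lidskii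

theorem exists_submodule_mem_of_lt {r : ℕ} (g : Fin r → ℕ → H) (n : ℕ) :
    ∃ R : Submodule ℂ H, ∃ _ : FiniteDimensional ℂ R, Module.finrank ℂ R ≤ r * n ∧
      ∀ a, ∀ i < n, g a i ∈ R := by
  let w : Fin r × Fin n → H := fun x => g x.1 x.2
  refine ⟨Submodule.span ℂ (Set.range w), FiniteDimensional.span_of_finite ℂ (Set.finite_range w),
    ?_, fun a i hi => Submodule.subset_span ⟨(a, ⟨i, hi⟩), rfl⟩⟩
  simpa [Set.finrank] using finrank_range_le_card (R := ℂ) w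

variable [CompleteSpace H]

/-- The partial sums that define the Dixmier trace of a general operator. -/
noncomputable def dixmierSum (G : H →L[ℂ] H) (N : ℕ) : ℂ :=
  (((∑ k ∈ Finset.range (N + 1), singularValue (realPart G : H →L[ℂ] H)⁺ k : ℝ) : ℂ) -
    ((∑ k ∈ Finset.range (N + 1), singularValue (realPart G : H →L[ℂ] H)⁻ k : ℝ) : ℂ)) +
  Complex.I *
    (((∑ k ∈ Finset.range (N + 1), singularValue (imaginaryPart G : H →L[ℂ] H)⁺ k : ℝ) : ℂ) -
      ((∑ k ∈ Finset.range (N + 1), singularValue (imaginaryPart G : H →L[ℂ] H)⁻ k : ℝ) : ℂ))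

/-- Linearity of `ω` gathers the four Dixmier traces of the definition into its value at one bounded
sequence. -/
theorem exists_dixmierTrace_eq (ω : lp (fun _ : ℕ => ℂ) ∞ →L[ℂ] ℂ) {G : H →L[ℂ] H}
    (hG : IsWeakSchatten 1 G) :
    ∃ c : lp (fun _ : ℕ => ℂ) ∞, (∀ N, c N = dixmierSum G N / (Real.log N : ℂ)) ∧
      dixmierTrace ω G hG = ω c := by
  let x (B : H →L[ℂ] H) (hB : IsWeakSchatten 1 B) : lp (fun _ : ℕ => ℂ) ∞ :=
    ⟨dixmierSeq B, memℓp_dixmierSeq hB⟩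
  have hre := hG.realPart one_ne_zero
  have him := hG.imaginaryPart one_ne_zero
  refine ⟨(x _ (hre.posPart one_ne_zero (realPart G).2) -
      x _ (hre.negPart one_ne_zero (realPart G).2)) +
    Complex.I • (x _ (him.posPart one_ne_zero (imaginaryPart G).2) -
      x _ (him.negPart one_ne_zero (imaginaryPart G).2)), fun N => ?_, ?_⟩
  · simp only [x, lp.coeFn_add, lp.coeFn_sub, lp.coeFn_smul, Pi.add_apply, Pi.sub_apply,
      Pi.smul_apply, dixmierSeq, dixmierSum, smul_eq_mul, Complex.ofReal_div]
    ring
  · simp only [map_add, map_sub, map_smul, smul_eq_mul]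
    rfl

theorem compressedTrace_eq_parts (R : Submodule ℂ H) [FiniteDimensional ℂ R] (G : H →L[ℂ] H) :
    compressedTrace R G =
      (compressedTrace R (realPart G : H →L[ℂ] H)⁺ -
        compressedTrace R (realPart G : H →L[ℂ] H)⁻) +
      Complex.I * (compressedTrace R (imaginaryPart G : H →L[ℂ] H)⁺ -
        compressedTrace R (imaginaryPart G : H →L[ℂ] H)⁻) := by
  rw [← compressedTrace_sub, ← compressedTrace_sub, ← compressedTrace_smul, ← compressedTrace_add,
    CFC.posPart_sub_negPart _ (realPart G).2, CFC.posPart_sub_negPart _ (imaginaryPart G).2,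
    realPart_add_I_smul_imaginaryPart]

theorem exists_norm_dixmierSum_sub_sum_inner_le {p : ℝ≥0∞} (hp : 1 ≤ p) (hp' : p ≠ ∞)
    {V G : H →L[ℂ] H} (hV : IsStrictlyPositiveOp V) (hVp : IsWeakSchatten p V)
    (e : HilbertBasis ℕ ℂ H) {v : ℕ → ℝ} (hv : Antitone v)
    (he : ∀ l, V (e l) = (v l : ℂ) • e l) (hG : IsWeakSchatten 1 G)
    (hGV : IsWeaklyModulated p V G) :
    ∃ K : ℝ, ∀ N, ‖dixmierSum G N - ∑ l ∈ Finset.range (N + 1), ⟪e l, G (e l)⟫_ℂ‖ ≤ K := by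
  have hinf : ¬ FiniteDimensional ℂ H := fun _ =>
    not_finite_iff_infinite.2 (inferInstanceAs (Infinite ℕ)) e.orthonormal.linearIndependent.finite
  have hre := hG.realPart one_ne_zero
  have him := hG.imaginaryPart one_ne_zero
  have hB1 := hre.posPart one_ne_zero (realPart G).2
  have hB2 := hre.negPart one_ne_zero (realPart G).2
  have hB3 := him.posPart one_ne_zero (imaginaryPart G).2
  have hB4 := him.negPart one_ne_zero (imaginaryPart G).2
  have hp1 := CFC.posPart_nonneg (realPart G : H →L[ℂ] H)
  have hp2 := CFC.negPart_nonneg (realPart G : H →L[ℂ] H)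
  have hp3 := CFC.posPart_nonneg (imaginaryPart G : H →L[ℂ] H)
  have hp4 := CFC.negPart_nonneg (imaginaryPart G : H →L[ℂ] H)
  have htr := fun (R : Submodule ℂ H) [FiniteDimensional ℂ R] => compressedTrace_eq_parts R G
  simp only [dixmierSum]
  generalize (realPart G : H →L[ℂ] H)⁺ = B1 at *
  generalize (realPart G : H →L[ℂ] H)⁻ = B2 at *
  generalize (imaginaryPart G : H →L[ℂ] H)⁺ = B3 at *
  generalize (imaginaryPart G : H →L[ℂ] H)⁻ = B4 at *
  -- The `5` counts the families placed in `R`: `e` and the eigenvectors of four positive operators.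
  -- Each comparison holds for every such `R`, so a common `R` serves all five.
  obtain ⟨g₁, K₁, h₁⟩ := exists_norm_compressedTrace_sub_sum_singularValue_le hp1 hB1 hinf 5
  obtain ⟨g₂, K₂, h₂⟩ := exists_norm_compressedTrace_sub_sum_singularValue_le hp2 hB2 hinf 5
  obtain ⟨g₃, K₃, h₃⟩ := exists_norm_compressedTrace_sub_sum_singularValue_le hp3 hB3 hinf 5
  obtain ⟨g₄, K₄, h₄⟩ := exists_norm_compressedTrace_sub_sum_singularValue_le hp4 hB4 hinf 5
  obtain ⟨K₀, h₀⟩ := exists_norm_compressedTrace_sub_sum_inner_le hp hp' hV hVp e hv he hGV 5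
  refine ⟨K₁ + K₂ + (K₃ + K₄) + K₀, fun N => ?_⟩
  obtain ⟨R, hfd, hcard, hmem⟩ := exists_submodule_mem_of_lt ![e, g₁, g₂, g₃, g₄] (N + 1)
  have b₁ := h₁ N R (hmem 1) hcard
  have b₂ := h₂ N R (hmem 2) hcard
  have b₃ := h₃ N R (hmem 3) hcard
  have b₄ := h₄ N R (hmem 4) hcard
  have b₀ := h₀ N R (hmem 0) hcard
  refine (norm_sub_le_norm_sub_add_norm_sub _ (compressedTrace R G) _).trans
    (add_le_add ?_ b₀)
  rw [norm_sub_rev, htr R, add_sub_add_comm, ← mul_sub,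
    sub_sub_sub_comm, sub_sub_sub_comm (compressedTrace R B3)]
  refine (norm_add_le _ _).trans (add_le_add ((norm_sub_le _ _).trans (add_le_add b₁ b₂)) ?_)
  rw [norm_mul, Complex.norm_I, one_mul]
  exact (norm_sub_le _ _).trans (add_le_add b₃ b₄)

end Lidskii

end DixmierTrace

theorem mainTheorem2 {H : Type*} [NormedAddCommGroup H] [InnerProductSpace ℂ H] [CompleteSpace H]
    (p : ENNReal) (hp : 1 ≤ p) (hp' : p ≠ ⊤)
    (V : H →L[ℂ] H) (hV : DixmierTrace.IsStrictlyPositiveOp V)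
    (hVp : DixmierTrace.IsWeakSchatten p V)
    (e : HilbertBasis ℕ ℂ H) (v : ℕ → ℝ) (hv : Antitone v)
    (he : ∀ l, V (e l) = (v l : ℂ) • e l)
    (G : H →L[ℂ] H) (hG : DixmierTrace.IsWeakSchatten 1 G)
    (hGV : DixmierTrace.IsWeaklyModulated p V G)
    (ω : lp (fun _ : ℕ => ℂ) ⊤ →L[ℂ] ℂ) (hω : DixmierTrace.IsExtendedLimit ω) :
    ∃ hRes : Memℓp (DixmierTrace.residueSeq e G) ⊤,
      DixmierTrace.dixmierTrace ω G hG = ω ⟨DixmierTrace.residueSeq e G, hRes⟩ := by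
  obtain ⟨K, hK⟩ :=
    DixmierTrace.exists_norm_dixmierSum_sub_sum_inner_le hp hp' hV hVp e hv he hG hGV
  obtain ⟨c, hc, htr⟩ := DixmierTrace.exists_dixmierTrace_eq ω hG
  -- The bound on the normalised sums is the supremum norm of `c`; at `N = 0, 1` the quotient is `0`
  -- by convention.
  have hlim := DixmierTrace.tendsto_div_log_sub_div_log hK (d := ‖c‖) fun N => by
    rw [← hc]
    exact lp.norm_apply_le_norm ENNReal.top_ne_zero c N
  rw [htr]
  exact hω.eq_of_tendsto_sub c (by simpa only [DixmierTrace.residueSeq, hc] using hlim)
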